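/- Let $\pi\colon E\to M$ be a smooth vector bundle over a smooth $n$-dimensional manifold, $J^\infty(\pi)$ its infinite jet space, $\mathcal F(\pi)$ the algebra of smooth functions of finite order on $J^\infty(\pi)$, and $\Lambda^*(\pi)$ the algebra of differential forms of finite order on it. Let $\mathcal{C}\Lambda^*(\pi)\subset\Lambda^*(\pi)$ be the ideal of forms that vanish on the Cartan planes (the planes tangent to the graphs $j^\infty\sigma$ of infinite jets of sections), and let $\Lambda^n_h(\pi)=\mathcal F(\pi)\cdot\pi_\infty^*\Lambda^n(M)$ be the horizontal $n$-forms. Let $\mathcal{E}\subset J^\infty(\pi)$ be the infinite prolongation of a system $F=0$, i.e. the set of points where $D_\alpha(F^i)=0$ for all $i$ and all multi-indices $\alpha$; here $F$ is a smooth section, of finite order, of the pullback to $J^\infty(\pi)$ of a smooth vector bundle over $M$. Let $I$ be the ideal of functions vanishing on $\mathcal{E}$. Let $\Lambda^*(\mathcal{E})$ be the quotient of $\Lambda^*(\pi)$ by the ideal generated by $I$ and $dI$, let $\mathcal{C}\Lambda^*(\mathcal{E})$ be the image of $\mathcal{C}\Lambda^*(\pi)$, and let $(E_r^{p,q}(\mathcal{E}),d_r)$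 be the spectral sequence of the complex $\Lambda^\bullet(\mathcal{E})$ filtered by the powers $\mathcal{C}^p\Lambda^\bullet(\mathcal{E})$ of the ideal $\mathcal{C}\Lambda^*(\mathcal{E})$, so that $E_0^{p,q}(\mathcal{E})=\mathcal{C}^p\Lambda^{p+q}(\mathcal{E})/\mathcal{C}^{p+1}\Lambda^{p+q}(\mathcal{E})$. Let $L\in\Lambda^n_h(\pi)$ be a horizontal $n$-form whose variational derivative $\mathrm{E}(L)$, given in adapted coordinates by $L=\lambda\,dx^1\wedge\dots\wedge dx^n\mapsto\sum_\alpha(-1)^{|\alpha|}D_\alpha(\partial\lambda/\partial u^i_\alpha)$, vanishes on $\mathcal{E}$. Let $\omega_L\in \mathcal{C}\Lambda^1(\pi)\wedge\pi_\infty^*\Lambda^{n-1}(M)$ be any form such that $$\mathcal{L}_{E_\varphi}L=\langle \mathrm{E}(L),\varphi\rangle+d_h(E_\varphi\lrcorner\,\omega_L)$$ for every evolutionary vector field $E_\varphi$, where $d_h$ is the horizontal differential, and let $l=(L+\omega_L)|_{\mathcal{E}}$. Then $dl\in \mathcal{C}^2\Lambda^{n+1}(\mathcal{E})$, and $dl$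 represents a $d_1$-closed element of $E_1^{2,n-1}(\mathcal{E})$ (the presymplectic structure corresponding to $L$), which in turn represents an element of $E_2^{2,n-1}(\mathcal{E})$. If this element of $E_2^{2,n-1}(\mathcal{E})$ is non-trivial, then $L|_{\mathcal{E}}\in E_0^{0,n}(\mathcal{E})$ represents a non-trivial element of $E_1^{0,n}(\mathcal{E})$, which represents a non-trivial element of $E_2^{0,n}(\mathcal{E})$. -/

import Mathlib

open scoped Manifold ContDiff Bundle

/-! ## Differential forms over a commutative algebra of functions

For the algebra `A` of smooth functions (of finite order) on a jet space, vector fields are the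
derivations of `A`, and a differential `k`-form is a finite sum of forms `f dg₁ ∧ … ∧ dg_k` with
`f, g₁, …, g_k` in `A`, evaluated on `k` vector fields. -/

namespace DiffCalc

section Algebra

variable {A : Type*} [CommRing A] [Algebra ℝ A]

/-- `A`-valued functions of `k` vector fields; the differential forms are those in `Forms A k`. -/
abbrev Cochain (A : Type*) [CommRing A] [Algebra ℝ A] (k : ℕ) : Type _ :=
  (Fin k → Derivation ℝ A A) → A

/-- The interior product `X ⌟ θ`. -/
def contract {k : ℕ} (X : Derivation ℝ A A) (θ : Cochain A (k + 1)) : Cochain A k :=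
  fun Y => θ (Fin.cons X Y)

/-- The Lie derivative along `X`. -/
def lieDer {k : ℕ} (X : Derivation ℝ A A) (θ : Cochain A k) : Cochain A k :=
  fun Y => X (θ Y) - ∑ i, θ (Function.update Y i ⁅X, Y i⁆)

/-- The de Rham differential: `X₀ ⌟ dθ = 𝓛_{X₀} θ - d (X₀ ⌟ θ)` (unfolding this recursion gives the
usual formula with the Lie brackets); on forms, `d (f dg₁ ∧ … ∧ dg_k) = df ∧ dg₁ ∧ … ∧ dg_k`,
see `extD_smul_wedgeD`. -/
def extD : (k : ℕ) → Cochain A k → Cochain A (k + 1)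
  | 0, θ => fun X => X 0 (θ (Fin.tail X))
  | k + 1, θ => fun X =>
      lieDer (X 0) θ (Fin.tail X) - extD k (contract (X 0) θ) (Fin.tail X)

/-- The form `dg₁ ∧ … ∧ dg_k`. -/
def wedgeD {k : ℕ} (g : Fin k → A) : Cochain A k :=
  fun X => Matrix.det (Matrix.of fun i j => X i (g j))

theorem extD_add (k : ℕ) (θ η : Cochain A k) : extD k (θ + η) = extD k θ + extD k η := by
  induction k with
  | zero => funext X; simp [extD]
  | succ k ih =>
    funext X
    have h : contract (X 0) (θ + η) = contract (X 0) θ + contract (X 0) η := rfl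
    simp only [extD, h, ih, lieDer, Pi.add_apply, map_add, Finset.sum_add_distrib]
    ring

theorem extD_smul (k : ℕ) (c : ℝ) (θ : Cochain A k) : extD k (c • θ) = c • extD k θ := by
  induction k with
  | zero => funext X; simp [extD]
  | succ k ih =>
    funext X
    have h : contract (X 0) (c • θ) = c • contract (X 0) θ := rfl
    simp only [extD, h, ih, lieDer, Pi.smul_apply, Derivation.map_smul, smul_sub,
      Finset.smul_sum]

theorem deriv_prod {ι : Type*} [DecidableEq ι] (X : Derivation ℝ A A) (s : Finset ι)
    (f : ι → A) :
    X (∏ i ∈ s, f i) = ∑ j ∈ s, X (f j) * ∏ i ∈ s.erase j, f i := by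
  induction s using Finset.induction_on with
  | empty => simp
  | insert a s ha ih =>
    rw [Finset.prod_insert ha, Derivation.leibniz, Finset.sum_insert ha,
      Finset.erase_insert ha, ih, smul_eq_mul, smul_eq_mul, Finset.mul_sum, add_comm]
    congr 1
    · ring
    · refine Finset.sum_congr rfl fun j hj => ?_
      have hja : a ≠ j := fun h => ha (h ▸ hj)
      rw [Finset.erase_insert_of_ne hja, Finset.prod_insert (by simp [ha])]
      ring

theorem deriv_det {k : ℕ} (X : Derivation ℝ A A) (M : Matrix (Fin (k + 1)) (Fin (k + 1)) A) :
    X M.det = ∑ j : Fin (k + 1), ∑ i : Fin (k + 1), (-1) ^ (i + j : ℕ) * X (M i j) *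
      (M.submatrix i.succAbove j.succAbove).det := by
  have h : X M.det = ∑ j, (M.updateCol j fun i => X (M i j)).det := by
    rw [Matrix.det_apply, map_sum]
    simp_rw [Matrix.det_apply]
    rw [Finset.sum_comm]
    refine Finset.sum_congr rfl fun σ _ => ?_
    rw [← Finset.smul_sum]
    rw [show X (Equiv.Perm.sign σ • ∏ i, M (σ i) i) = Equiv.Perm.sign σ • X (∏ i, M (σ i) i) by
      rcases Int.units_eq_one_or (Equiv.Perm.sign σ) with h | h <;> simp [h]]
    congr 1
    rw [deriv_prod]
    refine Finset.sum_congr rfl fun j _ => ?_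
    rw [← Finset.mul_prod_erase _ _ (Finset.mem_univ j)]
    congr 1
    · simp
    · refine Finset.prod_congr rfl fun i hi => ?_
      rw [Matrix.updateCol_ne (Finset.ne_of_mem_erase hi)]
  rw [h]
  refine Finset.sum_congr rfl fun j _ => ?_
  rw [Matrix.det_succ_column _ j]
  refine Finset.sum_congr rfl fun i _ => ?_
  simp

theorem wedgeD_cons_apply {k : ℕ} (f : A) (g : Fin k → A) (X : Fin (k + 1) → Derivation ℝ A A) :
    wedgeD (Fin.cons f g : Fin (k + 1) → A) X =
      ∑ i : Fin (k + 1), (-1) ^ (i : ℕ) * X i f * wedgeD g (fun a => X (i.succAbove a)) := by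
  rw [wedgeD, Matrix.det_succ_column_zero]
  refine Finset.sum_congr rfl fun i _ => ?_
  simp [wedgeD, Matrix.submatrix]

theorem contract_wedgeD {k : ℕ} (f : A) (g : Fin (k + 1) → A) (X : Derivation ℝ A A) :
    contract X (f • wedgeD g) =
      ∑ j : Fin (k + 1), ((-1) ^ (j : ℕ) * f * X (g j)) • wedgeD (fun a => g (j.succAbove a)) := by
  funext Y
  simp only [contract, Pi.smul_apply, wedgeD, smul_eq_mul, Finset.sum_apply]
  rw [Matrix.det_succ_row_zero, Finset.mul_sum]
  refine Finset.sum_congr rfl fun j _ => ?_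
  simp [Matrix.submatrix]
  ring

theorem extD_sum (k : ℕ) {ι : Type*} (s : Finset ι) (θ : ι → Cochain A k) :
    extD k (∑ i ∈ s, θ i) = ∑ i ∈ s, extD k (θ i) := by
  classical
  induction s using Finset.induction_on with
  | empty => simpa using extD_smul k 0 (0 : Cochain A k)
  | insert a s ha ih => rw [Finset.sum_insert ha, Finset.sum_insert ha, extD_add, ih]

theorem lieDer_wedgeD {k : ℕ} (f : A) (g : Fin (k + 1) → A) (X : Derivation ℝ A A)
    (Y : Fin (k + 1) → Derivation ℝ A A) :
    lieDer X (f • wedgeD g) Y = X f * wedgeD g Y +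
      f * ∑ j : Fin (k + 1), (-1) ^ (j : ℕ) *
        wedgeD (Fin.cons (X (g j)) fun a => g (j.succAbove a) : Fin (k + 1) → A) Y := by
  have h1 : ∀ i, wedgeD g (Function.update Y i ⁅X, Y i⁆) = ∑ j : Fin (k + 1),
      (-1) ^ (i + j : ℕ) * (⁅X, Y i⁆ (g j)) *
        wedgeD (fun a => g (j.succAbove a)) (fun a => Y (i.succAbove a)) := by
    intro i
    rw [wedgeD, Matrix.det_succ_row _ i]
    refine Finset.sum_congr rfl fun j _ => ?_
    simp [wedgeD, Matrix.submatrix]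
  simp only [lieDer, Pi.smul_apply, smul_eq_mul, Derivation.leibniz, h1, ← Finset.mul_sum]
  conv_lhs => rw [show wedgeD g Y = (Matrix.of fun i j => Y i (g j)).det from rfl]
  rw [deriv_det, Finset.sum_comm]
  have h2 : ∀ j : Fin (k + 1), (-1) ^ (j : ℕ) *
        wedgeD (Fin.cons (X (g j)) fun a => g (j.succAbove a) : Fin (k + 1) → A) Y =
      ∑ i : Fin (k + 1), (-1) ^ (i + j : ℕ) * (Y i (X (g j))) *
        wedgeD (fun a => g (j.succAbove a)) (fun a => Y (i.succAbove a)) := by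
    intro j
    rw [wedgeD_cons_apply, Finset.mul_sum]
    refine Finset.sum_congr rfl fun i _ => ?_
    rw [pow_add]; ring
  simp only [h2]
  rw [Finset.sum_comm (s := Finset.univ) (t := Finset.univ)
    (f := fun (j i : Fin (k + 1)) => (-1) ^ (i + j : ℕ) * (Y i (X (g j))) *
        wedgeD (fun a => g (j.succAbove a)) (fun a => Y (i.succAbove a)))]
  rw [add_sub_right_comm, ← mul_sub, ← Finset.sum_sub_distrib, add_comm]
  congr 1
  · rw [mul_comm]; rfl
  · congr 1
    refine Finset.sum_congr rfl fun i _ => ?_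
    rw [← Finset.sum_sub_distrib]
    refine Finset.sum_congr rfl fun j _ => ?_
    simp only [Derivation.commutator_apply, Matrix.of_apply, wedgeD, Matrix.submatrix]
    ring

theorem wedgeD_cons_mul {k : ℕ} (j : ℕ) (f c : A) (g : Fin k → A)
    (X : Fin (k + 1) → Derivation ℝ A A) :
    wedgeD (Fin.cons ((-1) ^ j * f * c) g : Fin (k + 1) → A) X =
      (-1) ^ j * (f * wedgeD (Fin.cons c g : Fin (k + 1) → A) X +
        c * wedgeD (Fin.cons f g : Fin (k + 1) → A) X) := by
  simp only [wedgeD_cons_apply, Finset.mul_sum, ← Finset.sum_add_distrib]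
  refine Finset.sum_congr rfl fun i _ => ?_
  have h : X i ((-1) ^ j) = 0 := by
    rcases neg_one_pow_eq_or A j with h | h <;> simp [h]
  simp only [Derivation.leibniz, smul_eq_mul, h]
  ring

theorem extD_smul_wedgeD (k : ℕ) (f : A) (g : Fin k → A) :
    extD k (f • wedgeD g) = wedgeD (Fin.cons f g : Fin (k + 1) → A) := by
  induction k generalizing f with
  | zero => funext X; simp [extD, wedgeD]
  | succ k ih =>
    funext X
    have h := congrFun (contract_wedgeD 1 (Fin.cons f g : Fin (k + 2) → A) (X 0)) (Fin.tail X)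
    rw [one_smul, contract, Fin.cons_self_tail] at h
    rw [h]
    change lieDer (X 0) (f • wedgeD g) (Fin.tail X) -
      extD k (contract (X 0) (f • wedgeD g)) (Fin.tail X) = _
    rw [lieDer_wedgeD, contract_wedgeD, extD_sum]
    simp only [ih, Finset.sum_apply, wedgeD_cons_mul, Fin.sum_univ_succ (n := k + 1)]
    have h0 : ∀ j : Fin (k + 1), (fun a => (Fin.cons f g : Fin (k + 2) → A) (j.succ.succAbove a)) =
        (Fin.cons f fun a => g (j.succAbove a) : Fin (k + 1) → A) := by
      intro j
      funext a
      refine Fin.cases ?_ (fun a => ?_) a <;> simp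
    simp only [h0, Pi.smul_apply, smul_eq_mul, Finset.mul_sum, Fin.cons_succ, Fin.succAbove_zero,
      Fin.cons_zero, Fin.val_zero, pow_zero, Fin.val_succ, one_mul, mul_one]
    rw [add_sub_assoc, ← Finset.sum_sub_distrib]
    congr 1
    refine Finset.sum_congr rfl fun j _ => ?_
    ring

/-- `d (X ⌟ θ)`, which has the same degree as `θ` (it is zero in degree zero). -/
def extDContract (X : Derivation ℝ A A) : {k : ℕ} → Cochain A k → Cochain A k
  | 0, _ => 0
  | k + 1, θ => extD k (contract X θ)

/-- The module `Λᵏ` of differential `k`-forms. -/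
def Forms (A : Type*) [CommRing A] [Algebra ℝ A] (k : ℕ) : Submodule A (Cochain A k) :=
  Submodule.span A (Set.range wedgeD)

/-- `I · Λᵏ + dI ∧ Λᵏ⁻¹`, the degree `k` part of the ideal generated by `I` and `dI`. -/
def idealForms (I : Ideal A) (k : ℕ) : Submodule A (Cochain A k) :=
  Submodule.span A ({θ | ∃ f ∈ I, ∃ g : Fin k → A, θ = f • wedgeD g} ∪
    {θ | ∃ g : Fin k → A, (∃ j, g j ∈ I) ∧ θ = wedgeD g})

theorem extD_mem_forms {k : ℕ} {θ : Cochain A k} (h : θ ∈ Forms A k) :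
    extD k θ ∈ Forms A (k + 1) := by
  refine Submodule.closure_induction (p := fun θ _ => extD k θ ∈ Forms A (k + 1)) ?_ ?_ ?_ h
  · have := extD_smul k 0 (0 : Cochain A k)
    simp only [zero_smul] at this
    rw [this]; exact Submodule.zero_mem _
  · intro x y _ _ hx hy
    rw [extD_add]; exact Submodule.add_mem _ hx hy
  · rintro r x ⟨g, rfl⟩
    rw [extD_smul_wedgeD]; exact Submodule.subset_span ⟨_, rfl⟩

theorem extD_extD {k : ℕ} {θ : Cochain A k} (h : θ ∈ Forms A k) :
    extD (k + 1) (extD k θ) = 0 := by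
  have h0 : ∀ k, extD k (0 : Cochain A k) = 0 := fun k => by
    simpa using extD_smul k 0 (0 : Cochain A k)
  refine Submodule.closure_induction (p := fun θ _ => extD (k + 1) (extD k θ) = 0) ?_ ?_ ?_ h
  · rw [h0, h0]
  · intro x y _ _ hx hy
    rw [extD_add, extD_add, hx, hy, add_zero]
  · rintro r x ⟨g, rfl⟩
    rw [extD_smul_wedgeD, ← one_smul A (wedgeD _), extD_smul_wedgeD]
    funext X
    rw [wedgeD_cons_apply]
    simp

theorem extD_mem_idealForms (I : Ideal A) {k : ℕ} {θ : Cochain A k} (h : θ ∈ idealForms I k) :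
    extD k θ ∈ idealForms I (k + 1) := by
  refine Submodule.closure_induction (p := fun θ _ => extD k θ ∈ idealForms I (k + 1)) ?_ ?_ ?_ h
  · have := extD_smul k 0 (0 : Cochain A k)
    simp only [zero_smul] at this
    rw [this]; exact Submodule.zero_mem _
  · intro x y _ _ hx hy
    rw [extD_add]; exact Submodule.add_mem _ hx hy
  · rintro r x (⟨f, hf, g, rfl⟩ | ⟨g, ⟨j, hj⟩, rfl⟩)
    · rw [smul_smul, extD_smul_wedgeD]
      exact Submodule.subset_span (Or.inr ⟨_, ⟨0, by simpa using I.mul_mem_left r hf⟩, rfl⟩)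
    · rw [extD_smul_wedgeD]
      exact Submodule.subset_span (Or.inr ⟨_, ⟨j.succ, by simpa using hj⟩, rfl⟩)

/-- The de Rham differential `Λᵏ → Λᵏ⁺¹`. -/
def dForms (k : ℕ) : Forms A k →ₗ[ℝ] Forms A (k + 1) where
  toFun θ := ⟨extD k θ.1, extD_mem_forms θ.2⟩
  map_add' θ η := Subtype.ext (extD_add k θ.1 η.1)
  map_smul' c θ := Subtype.ext (extD_smul k c θ.1)

/-- The forms that are zero on the subset with vanishing ideal `I`. -/
def relForms (I : Ideal A) (k : ℕ) : Submodule ℝ (Forms A k) :=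
  ((idealForms I k).comap (Forms A k).subtype).restrictScalars ℝ

/-- The module `Λᵏ(𝓔)` of differential forms on the subset `𝓔` with vanishing ideal `I`: the degree
`k` part of the quotient of `Λ*` by the ideal generated by `I` and `dI`. This is the exterior
algebra of `Λ¹ / (I · Λ¹ + A · dI)` over `A / I`. -/
def FormsOn (I : Ideal A) (k : ℕ) : Type _ := Forms A k ⧸ relForms I k

instance (I : Ideal A) (k : ℕ) : AddCommGroup (FormsOn I k) :=
  inferInstanceAs (AddCommGroup (Forms A k ⧸ relForms I k))

instance (I : Ideal A) (k : ℕ) : Module ℝ (FormsOn I k) :=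
  inferInstanceAs (Module ℝ (Forms A k ⧸ relForms I k))

/-- Restriction of forms to the subset with vanishing ideal `I`. -/
def restrictForm (I : Ideal A) (k : ℕ) : Forms A k →ₗ[ℝ] FormsOn I k := (relForms I k).mkQ

/-- The de Rham differential `Λᵏ(𝓔) → Λᵏ⁺¹(𝓔)`. -/
def dOn (I : Ideal A) (k : ℕ) : FormsOn I k →ₗ[ℝ] FormsOn I (k + 1) :=
  Submodule.mapQ _ _ (dForms k) fun _ hθ => extD_mem_idealForms I hθ

theorem dOn_dOn (I : Ideal A) (k : ℕ) (θ : FormsOn I k) : dOn I (k + 1) (dOn I k θ) = 0 := by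
  obtain ⟨θ, rfl⟩ := Submodule.Quotient.mk_surjective _ θ
  change Submodule.Quotient.mk (dForms (k + 1) (dForms k θ)) = _
  rw [show dForms (k + 1) (dForms k θ) = 0 from Subtype.ext (extD_extD θ.2)]
  rfl

end Algebra

/-! ## The spectral sequence of a filtered complex

`C` is a cochain complex with differential `d`, and `F p k` is the `p`-th step of a decreasing
filtration in degree `k`. The index `k` is the total degree: `Page d F r p k` is the group
usually written `E_r^{p, q}` with `q = k - p`. The filtration is understood to be everything for
`p ≤ 0`, which is why `p + 1 - r` may be read in the natural numbers. -/

section SpectralSequence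

variable {C : ℕ → Type*} [∀ k, AddCommGroup (C k)] [∀ k, Module ℝ (C k)]
  (d : ∀ k, C k →ₗ[ℝ] C (k + 1)) (F : ℕ → ∀ k, Submodule ℝ (C k))

/-- `Z_r^p = {z ∈ F^p | dz ∈ F^{p + r}}`. -/
def cyc (r p k : ℕ) : Submodule ℝ (C k) := F p k ⊓ (F (p + r) (k + 1)).comap (d k)

/-- `B_r^p = {z ∈ F^{p + 1} | dz ∈ F^{p + r}} + (F^p ∩ d F^{p + 1 - r})`. -/
def bnd (r p : ℕ) : ∀ k, Submodule ℝ (C k)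
  | 0 => F (p + 1) 0 ⊓ (F (p + r) 1).comap (d 0)
  | k + 1 => (F (p + 1) (k + 1) ⊓ (F (p + r) (k + 2)).comap (d (k + 1))) ⊔
      (F p (k + 1) ⊓ (F (p + 1 - r) k).map (d k))

/-- `E_r^{p, q} = Z_r^p / B_r^p` in total degree `k = p + q`. In particular `E_0` is the graded
object of the filtration, and `E_{r + 1}` is the cohomology of `d_r` on `E_r`. -/
abbrev Page (r p k : ℕ) : Type _ := cyc d F r p k ⧸ (bnd d F r p k).submoduleOf (cyc d F r p k)

/-- `x` is the element of `E_r^{p, q}` that `z` gives rise to. -/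
def IsClassOf {r p k : ℕ} (z : C k) (x : Page d F r p k) : Prop :=
  ∃ h : z ∈ cyc d F r p k, x = Submodule.Quotient.mk ⟨z, h⟩

/-- The element `x` of `E_r^{p, q}` represents the element `y` of `E_{r + 1}^{p, q}`, that is,
`x` is in the kernel of `d_r` and `y` is its cohomology class. -/
def Represents {r p k : ℕ} (x : Page d F r p k) (y : Page d F (r + 1) p k) : Prop :=
  ∃ z : C k, IsClassOf d F z x ∧ IsClassOf d F z y

/-- The differential `d_r : E_r^{p, q} → E_r^{p + r, q + 1 - r}`, induced by `d`. -/
def pageD (hd : ∀ k z, d (k + 1) (d k z) = 0) (r p k : ℕ) :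
    Page d F r p k →ₗ[ℝ] Page d F r (p + r) (k + 1) :=
  Submodule.mapQ _ _
    ((d k).restrict (p := cyc d F r p k) (q := cyc d F r (p + r) (k + 1)) fun z hz =>
      ⟨hz.2, by simp [hd]⟩) <| by
    rintro ⟨z, hz⟩ hb
    change d k z ∈ bnd d F r (p + r) (k + 1)
    have key : ∀ c ∈ F (p + 1) k, d k c ∈ F (p + r) (k + 1) →
        d k c ∈ bnd d F r (p + r) (k + 1) := fun c hc hdc =>
      Submodule.mem_sup_right ⟨hdc, c, by rwa [show p + r + 1 - r = p + 1 by omega], rfl⟩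
    cases k with
    | zero => exact key z hb.1 hb.2
    | succ k =>
      obtain ⟨c, hc, _, ⟨_, e, _, rfl⟩, h⟩ :=
        Submodule.mem_sup.1 (show z ∈ bnd d F r p (k + 1) from hb)
      rw [← h, map_add, hd, add_zero]
      exact key c hc.1 hc.2

end SpectralSequence

end DiffCalc

/-! ## Jets -/

namespace JetGeom

open DiffCalc

section Coordinates

/-- The space with coordinates `xʲ` and `uⁱ_α`, where `α` is a multi-index. -/
abbrev JetCoords (n m : ℕ) : Type := EuclideanSpace ℝ (Fin n) × (Fin m → (Fin n → ℕ) → ℝ)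

/-- `T₁^{α₁} ∘ … ∘ T_n^{α_n}`. -/
def iterOps {β : Type*} {n : ℕ} (T : Fin n → β → β) (α : Fin n → ℕ) (b : β) : β :=
  (List.ofFn fun j => (T j)^[α j]).foldr (fun S c => S c) b

/-- `∂h / ∂xʲ`. -/
noncomputable def basePartial {n : ℕ} (j : Fin n) (h : EuclideanSpace ℝ (Fin n) → ℝ) :
    EuclideanSpace ℝ (Fin n) → ℝ :=
  fun y => lineDeriv ℝ h y (EuclideanSpace.single j 1)

/-- `∂G / ∂uⁱ_α`. -/
noncomputable def fibrePartial {n m : ℕ} (i : Fin m) (α : Fin n → ℕ) (G : JetCoords n m → ℝ) :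
    JetCoords n m → ℝ :=
  fun p => lineDeriv ℝ G p (0, Pi.single i (Pi.single α 1))

/-- The total derivative `D_{xʲ} = ∂_{xʲ} + ∑ uⁱ_{α + xʲ} ∂_{uⁱ_α}`. -/
noncomputable def totalD {n m : ℕ} (j : Fin n) (G : JetCoords n m → ℝ) : JetCoords n m → ℝ :=
  fun p => lineDeriv ℝ G p (EuclideanSpace.single j 1, 0) +
    ∑ᶠ a : Fin m × (Fin n → ℕ), p.2 a.1 (a.2 + Pi.single j 1) * fibrePartial a.1 a.2 G p

/-- `δG / δuⁱ = ∑_α (-1)^{|α|} D_α (∂G / ∂uⁱ_α)`. -/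
noncomputable def varDeriv {n m : ℕ} (i : Fin m) (G : JetCoords n m → ℝ) : JetCoords n m → ℝ :=
  fun p => ∑ᶠ α : Fin n → ℕ, (-1) ^ (∑ j, α j) * iterOps totalD α (fibrePartial i α G) p

/-- The multi-indices of length at most `k`. -/
def multiIdx (n k : ℕ) : Finset (Fin n → ℕ) :=
  (Fintype.piFinset fun _ => Finset.range (k + 1)).filter fun α => ∑ j, α j ≤ k

/-- `G` is, over `U`, a smooth function of the `xʲ` and of the `uⁱ_α` with `|α| ≤ k`. -/
def SmoothOfOrder {n m : ℕ} (k : ℕ) (U : Set (EuclideanSpace ℝ (Fin n)))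
    (G : JetCoords n m → ℝ) : Prop :=
  ∃ g : EuclideanSpace ℝ (Fin n) × (Fin m → multiIdx n k → ℝ) → ℝ,
    ContDiffOn ℝ ∞ g (U ×ˢ Set.univ) ∧ ∀ p, p.1 ∈ U → G p = g (p.1, fun i α => p.2 i α)

theorem multiIdx_mono {n k k' : ℕ} (h : k ≤ k') : multiIdx n k ⊆ multiIdx n k' := by
  intro α hα
  simp only [multiIdx, Finset.mem_filter, Fintype.mem_piFinset, Finset.mem_range] at hα ⊢
  exact ⟨fun i => by have := hα.1 i; omega, hα.2.trans h⟩

theorem SmoothOfOrder.mono {n m k k' : ℕ} {U : Set (EuclideanSpace ℝ (Fin n))}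
    {G : JetCoords n m → ℝ} (hG : SmoothOfOrder k U G) (h : k ≤ k') : SmoothOfOrder k' U G := by
  obtain ⟨g, hg, hGg⟩ := hG
  refine ⟨fun p => g (p.1, fun i α => p.2 i ⟨α, multiIdx_mono h α.2⟩), ?_, hGg⟩
  refine hg.comp (t := U ×ˢ Set.univ) (ContDiff.contDiffOn ?_) fun p hp => ⟨hp.1, trivial⟩
  fun_prop

end Coordinates

section Bundle

variable (n m : ℕ) {M : Type*} [TopologicalSpace M] [ChartedSpace (EuclideanSpace ℝ (Fin n)) M]
  (V : M → Type*) [TopologicalSpace (Bundle.TotalSpace (Fin m → ℝ) V)]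
  [∀ x, TopologicalSpace (V x)] [∀ x, AddCommGroup (V x)] [∀ x, Module ℝ (V x)]
  [FiberBundle (Fin m → ℝ) V]

/-- The domain of the adapted coordinates around `x₀`. -/
def adaptedDom (x₀ : M) : Set M :=
  (chartAt (EuclideanSpace ℝ (Fin n)) x₀).source ∩ (trivializationAt (Fin m → ℝ) V x₀).baseSet

/-- The value at `x` of `uⁱ_α` for the section `s`, in the adapted coordinates around `x₀`: the
partial derivative with multi-index `α` of the `i`-th component of `s`. -/
noncomputable def jetCoord (x₀ : M) (s : ∀ x, V x) (x : M) (i : Fin m) (α : Fin n → ℕ) : ℝ :=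
  iterOps basePartial α
    (fun y => (trivializationAt (Fin m → ℝ) V x₀
      ⟨(chartAt (EuclideanSpace ℝ (Fin n)) x₀).symm y,
        s ((chartAt (EuclideanSpace ℝ (Fin n)) x₀).symm y)⟩).2 i)
    (chartAt (EuclideanSpace ℝ (Fin n)) x₀ x)

variable [VectorBundle ℝ (Fin m → ℝ) V]

/-- Smooth sections of the bundle. -/
abbrev Sec : Type _ := ContMDiffSection (𝓡 n) (Fin m → ℝ) ∞ V

/-- Two pairs of a point and a section have the same infinite jet if the points are the same and
all partial derivatives there are the same in adapted coordinates. -/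
def jetSetoid : Setoid (M × Sec n m V) where
  r a b := a.1 = b.1 ∧ ∀ x₀, a.1 ∈ adaptedDom n m V x₀ → ∀ i α,
    jetCoord n m V x₀ a.2 a.1 i α = jetCoord n m V x₀ b.2 b.1 i α
  iseqv :=
    { refl := fun _ => ⟨rfl, fun _ _ _ _ => rfl⟩
      symm := fun {_ _} h => ⟨h.1.symm, fun x₀ hx i α => (h.2 x₀ (h.1 ▸ hx) i α).symm⟩
      trans := fun {_ _ _} h h' => ⟨h.1.trans h'.1, fun x₀ hx i α =>
        (h.2 x₀ hx i α).trans (h'.2 x₀ (h.1 ▸ hx) i α)⟩ }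

/-- The infinite jet space `J^∞(π)`. (Every jet of a local section is the jet of a global one.) -/
def Jet : Type _ := Quotient (jetSetoid n m V)

variable {n m V}

/-- The infinite jet of the section `σ` at `x`. -/
def jet (x : M) (σ : Sec n m V) : Jet n m V := Quotient.mk (jetSetoid n m V) (x, σ)

/-- The projection `π_∞ : J^∞(π) → M`. -/
def Jet.base (ρ : Jet n m V) : M :=
  Quotient.lift (s := jetSetoid n m V) (fun a => a.1) (fun _ _ h => And.left h) ρ

open scoped Classical in
/-- The adapted coordinates around `x₀` on the infinite jet space (zero outside their domain). -/
noncomputable def Jet.coords (x₀ : M) (ρ : Jet n m V) : JetCoords n m :=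
  Quotient.lift
    (fun a : M × Sec n m V => if a.1 ∈ adaptedDom n m V x₀ then
      ((chartAt (EuclideanSpace ℝ (Fin n)) x₀ a.1, jetCoord n m V x₀ a.2 a.1) : JetCoords n m)
      else 0)
    (by
      rintro ⟨x, σ⟩ ⟨y, τ⟩ ⟨h, h'⟩
      obtain rfl : x = y := h
      by_cases hx : x ∈ adaptedDom n m V x₀
      · simp only [hx, if_true]
        exact Prod.ext rfl (funext fun i => funext fun α => h' x₀ hx i α)
      · simp only [hx, if_false]) ρ

/-- Over the subset `U` of the domain of the adapted coordinates around `x₀`, the function `f` is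
the smooth function `G` of these coordinates, of order at most `k`. -/
def LocalRep (k : ℕ) (x₀ : M) (U : Set M) (f : Jet n m V → ℝ) (G : JetCoords n m → ℝ) : Prop :=
  SmoothOfOrder k (chartAt (EuclideanSpace ℝ (Fin n)) x₀ '' U) G ∧
    ∀ ρ : Jet n m V, ρ.base ∈ U → f ρ = G (ρ.coords x₀)

variable (n m V)

/-- The algebra `𝓕(π)` of smooth functions on `J^∞(π)`; each is of some finite order. -/
def JetFun : Subalgebra ℝ (Jet n m V → ℝ) where
  carrier := {f | ∃ k, ∀ x₀, ∃ G, LocalRep k x₀ (adaptedDom n m V x₀) f G}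
  mul_mem' := by
    rintro f f' ⟨k, h⟩ ⟨k', h'⟩
    refine ⟨max k k', fun x₀ => ?_⟩
    obtain ⟨G, hG, hf⟩ := h x₀
    obtain ⟨G', hG', hf'⟩ := h' x₀
    obtain ⟨g, hg, e⟩ := hG.mono (le_max_left k k')
    obtain ⟨g', hg', e'⟩ := hG'.mono (le_max_right k k')
    exact ⟨G * G', ⟨g * g', hg.mul hg', fun p hp => by simp [e p hp, e' p hp]⟩,
      fun ρ hρ => by simp [hf ρ hρ, hf' ρ hρ]⟩
  add_mem' := by
    rintro f f' ⟨k, h⟩ ⟨k', h'⟩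
    refine ⟨max k k', fun x₀ => ?_⟩
    obtain ⟨G, hG, hf⟩ := h x₀
    obtain ⟨G', hG', hf'⟩ := h' x₀
    obtain ⟨g, hg, e⟩ := hG.mono (le_max_left k k')
    obtain ⟨g', hg', e'⟩ := hG'.mono (le_max_right k k')
    exact ⟨G + G', ⟨g + g', hg.add hg', fun p hp => by simp [e p hp, e' p hp]⟩,
      fun ρ hρ => by simp [hf ρ hρ, hf' ρ hρ]⟩
  algebraMap_mem' c :=
    ⟨0, fun _ => ⟨fun _ => c, ⟨fun _ => c, contDiffOn_const, fun _ _ => rfl⟩, fun _ _ => rfl⟩⟩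

/-- Vector fields on `J^∞(π)`. -/
abbrev JetField : Type _ := Derivation ℝ (JetFun n m V) (JetFun n m V)

/-- Differential `k`-forms on `J^∞(π)`. -/
abbrev JetForms (k : ℕ) : Type _ := Forms (JetFun n m V) k

/-- Smooth sections, of finite order, of the pullback to `J^∞(π)` of a vector bundle `W` of rank
`l` over `M`; equivalently, nonlinear differential operators from sections of `V` to sections
of `W`. For `W = V` these are the elements of `ϰ(π)`. -/
structure JetSection (l : ℕ) (W : M → Type*) [TopologicalSpace (Bundle.TotalSpace (Fin l → ℝ) W)]
    [∀ x, TopologicalSpace (W x)] [FiberBundle (Fin l → ℝ) W] where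
  /-- the value at a jet -/
  val : ∀ ρ : Jet n m V, W ρ.base
  smooth : ∃ k, ∀ x₀ i, ∃ G, LocalRep k x₀
    (adaptedDom n m V x₀ ∩ (trivializationAt (Fin l → ℝ) W x₀).baseSet)
    (fun ρ => (trivializationAt (Fin l → ℝ) W x₀ ⟨ρ.base, val ρ⟩).2 i) G

variable {n m V}

/-- The infinite prolongation of the equation `F = 0`: the set of the infinite jets at which all
`D_α (Fⁱ)` are zero, in adapted coordinates. -/
def prolongation {l : ℕ} {W : M → Type*} [TopologicalSpace (Bundle.TotalSpace (Fin l → ℝ) W)]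
    [∀ x, TopologicalSpace (W x)] [FiberBundle (Fin l → ℝ) W] (F : JetSection n m V l W) :
    Set (Jet n m V) :=
  {ρ | ∀ x₀, ρ.base ∈ adaptedDom n m V x₀ ∩ (trivializationAt (Fin l → ℝ) W x₀).baseSet →
    ∀ i k G, LocalRep k x₀ (adaptedDom n m V x₀ ∩ (trivializationAt (Fin l → ℝ) W x₀).baseSet)
      (fun ρ => (trivializationAt (Fin l → ℝ) W x₀ ⟨ρ.base, F.val ρ⟩).2 i) G →
    ∀ α, iterOps totalD α G (ρ.coords x₀) = 0}

/-- The ideal of the functions that vanish on `S`. -/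
def vanishingIdeal (S : Set (Jet n m V)) : Ideal (JetFun n m V) where
  carrier := {f | ∀ ρ ∈ S, f.1 ρ = 0}
  add_mem' hf hg ρ hρ := by simp [hf ρ hρ, hg ρ hρ]
  zero_mem' _ _ := rfl
  smul_mem' c f hf ρ hρ := by simp [hf ρ hρ]

/-! ### The Cartan distribution -/

/-- The value of `X` at `ρ` is the vector of the Cartan plane that projects to the vector `v` of
`M`, i.e. the image of `v` under the differential of the jet prolongation of a section. -/
def IsLiftAt (X : JetField n m V) (ρ : Jet n m V) (v : TangentSpace (𝓡 n) ρ.base) : Prop :=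
  ∀ (x : M) (σ : Sec n m V), jet x σ = ρ → ∀ f : JetFun n m V,
    (X f).1 ρ = mfderiv (𝓡 n) 𝓘(ℝ, ℝ) (fun y => f.1 (jet y σ)) ρ.base v

/-- The value of `X` at `ρ` lies in the Cartan plane. -/
def IsCartanAt (X : JetField n m V) (ρ : Jet n m V) : Prop := ∃ v, IsLiftAt X ρ v

/-- The value of `X` at `ρ` is tangent to the fibre of `π_∞`. -/
def IsVerticalAt (X : JetField n m V) (ρ : Jet n m V) : Prop :=
  ∀ f : JetFun n m V, (∀ ρ₁ ρ₂ : Jet n m V, ρ₁.base = ρ₂.base → f.1 ρ₁ = f.1 ρ₂) → (X f).1 ρ = 0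

/-- The value at `ρ` of the `k`-form `θ` lies in the `p`-th power of the ideal generated by Cartan
`1`-forms: `θ` is zero there as soon as at least `k - p + 1` of its arguments are in the Cartan
plane. -/
def InCartanPowAt (p : ℕ) {k : ℕ} (θ : Cochain (JetFun n m V) k) (ρ : Jet n m V) : Prop :=
  ∀ (X : Fin k → JetField n m V) (s : Finset (Fin k)), k + 1 ≤ s.card + p →
    (∀ i ∈ s, IsCartanAt (X i) ρ) → (θ X).1 ρ = 0

/-- The filtration `𝓒^pΛᵏ(𝓔)` of the forms on `𝓔` by the powers of the Cartan ideal: the forms whose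
value at each point of `𝓔` lies in the `p`-th power of the ideal. (A form on the jet space with this
property is the sum of one that has it everywhere and of one that is zero at the points of `𝓔`.) -/
def cartanFiltration (S : Set (Jet n m V)) (p k : ℕ) :
    Submodule ℝ (FormsOn (vanishingIdeal S) k) :=
  Submodule.map (restrictForm (vanishingIdeal S) k)
    { carrier := {θ | ∀ ρ ∈ S, InCartanPowAt p θ.1 ρ}
      add_mem' := fun hθ hη ρ hρ X s hs hX => by
        simp [hθ ρ hρ X s hs hX, hη ρ hρ X s hs hX]
      zero_mem' := fun _ _ _ _ _ _ => rfl
      smul_mem' := fun c θ hθ ρ hρ X s hs hX => by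
        simp [hθ ρ hρ X s hs hX] }

/-- The group `E_r^{p, q}(𝓔)` of the Vinogradov `𝓒`-spectral sequence, in total degree
`k = p + q`. -/
abbrev VinE (S : Set (Jet n m V)) (r p k : ℕ) : Type _ :=
  Page (dOn (vanishingIdeal S)) (cartanFiltration S) r p k

/-- The differential `d_r : E_r^{p, q}(𝓔) → E_r^{p + r, q + 1 - r}(𝓔)`. -/
def vinD (S : Set (Jet n m V)) (r p k : ℕ) : VinE S r p k →ₗ[ℝ] VinE S r (p + r) (k + 1) :=
  pageD _ _ (dOn_dOn (vanishingIdeal S)) r p k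

/-! ### Lagrangians -/

/-- `θ` is a horizontal form, an element of `𝓕(π) · π_∞^* Λᵏ(M)`: it is zero if one of its
arguments is vertical. -/
def IsHorizontal {k : ℕ} (θ : Cochain (JetFun n m V) k) : Prop :=
  ∀ (X : Fin k → JetField n m V) (ρ : Jet n m V), (∃ i, IsVerticalAt (X i) ρ) → (θ X).1 ρ = 0

/-- `dx¹ ∧ … ∧ dxⁿ` for the chart around `x₀`. -/
noncomputable def coordVol (x₀ : M) {x : M} (v : Fin n → TangentSpace (𝓡 n) x) : ℝ :=
  Matrix.det (Matrix.of fun a b =>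
    (show EuclideanSpace ℝ (Fin n) from
      mfderiv (𝓡 n) (𝓡 n) (chartAt (EuclideanSpace ℝ (Fin n)) x₀) x (v a)) b)

/-- `L = lam dx¹ ∧ … ∧ dxⁿ` in adapted coordinates around `x₀`. -/
def IsDensity (x₀ : M) (L : Cochain (JetFun n m V) n) (lam : JetCoords n m → ℝ) : Prop :=
  (∃ k, SmoothOfOrder k (chartAt (EuclideanSpace ℝ (Fin n)) x₀ '' adaptedDom n m V x₀) lam) ∧
    ∀ ρ : Jet n m V, ρ.base ∈ adaptedDom n m V x₀ →
      ∀ (X : Fin n → JetField n m V) (v : Fin n → TangentSpace (𝓡 n) ρ.base),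
        (∀ a, IsLiftAt (X a) ρ (v a)) → (L X).1 ρ = lam (ρ.coords x₀) * coordVol x₀ v

open scoped Classical in
/-- The density of `L` in adapted coordinates around `x₀` (it exists, and is unique over the domain
of the coordinates, for each `n`-form `L`). -/
noncomputable def density (x₀ : M) (L : Cochain (JetFun n m V) n) : JetCoords n m → ℝ :=
  if h : ∃ lam, IsDensity x₀ L lam then h.choose else 0

/-- The value at `ρ` of the variational derivative `E(L)`, an element of
`Hom(ϰ(π), Λⁿ_h(π))`: `⟨E(L), w⟩ = δlam / δuⁱ wⁱ dx¹ ∧ … ∧ dxⁿ` for `w` in the fibre of the bundle,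
evaluated on the tangent vectors `v`, in adapted coordinates around the base point of `ρ`. -/
noncomputable def eulerForm (L : Cochain (JetFun n m V) n) (ρ : Jet n m V) (w : V ρ.base)
    (v : Fin n → TangentSpace (𝓡 n) ρ.base) : ℝ :=
  (∑ i, varDeriv i (density ρ.base L) (ρ.coords ρ.base) *
    (trivializationAt (Fin m → ℝ) V ρ.base ⟨ρ.base, w⟩).2 i) * coordVol ρ.base v

/-- The variational derivative `E(L)` vanishes on `S`. -/
def EulerVanishesOn (L : Cochain (JetFun n m V) n) (S : Set (Jet n m V)) : Prop :=
  ∀ ρ ∈ S, ∀ w v, eulerForm L ρ w v = 0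

variable [ContMDiffVectorBundle ∞ (Fin m → ℝ) V (𝓡 n)]

/-- `X` is the evolutionary vector field `E_φ = D_α(φⁱ) ∂_{uⁱ_α}`: at the jet of `σ` it is the
velocity of the jets of `σ + ε τ`, where `τ` is the section `y ↦ φ(j_y σ)`. -/
def IsEvolutionary (φ : JetSection n m V m V) (X : JetField n m V) : Prop :=
  ∀ σ : Sec n m V, ∃ τ : Sec n m V, (∀ y, τ y = φ.val (jet y σ)) ∧
    ∀ (x : M) (f : JetFun n m V),
      (X f).1 (jet x σ) = deriv (fun ε : ℝ => f.1 (jet x (σ + ε • τ))) 0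

/-- `θ` is a form as in the Noether formula for `L`: it lies in
`𝓒Λ¹(π) ∧ π_∞^* Λⁿ⁻¹(M)` (it is zero if all its arguments are in the Cartan plane, or if two of
them are vertical), and, for each `φ` in `ϰ(π)`,
`𝓛_{E_φ} L = ⟨E(L), φ⟩ + d_h (E_φ ⌟ θ)` as horizontal forms, i.e. on arguments in the Cartan
distribution. -/
def IsNoetherForm (L θ : Cochain (JetFun n m V) n) : Prop :=
  (∀ ρ, InCartanPowAt 1 θ ρ) ∧
  (∀ (X : Fin n → JetField n m V) (ρ : Jet n m V),
    (∃ a b, a ≠ b ∧ IsVerticalAt (X a) ρ ∧ IsVerticalAt (X b) ρ) → (θ X).1 ρ = 0) ∧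
  ∀ (φ : JetSection n m V m V) (X : JetField n m V), IsEvolutionary φ X →
    ∀ (ρ : Jet n m V) (Y : Fin n → JetField n m V) (v : Fin n → TangentSpace (𝓡 n) ρ.base),
      (∀ a, IsLiftAt (Y a) ρ (v a)) →
        (lieDer X L Y).1 ρ = eulerForm L ρ (φ.val ρ) v + (extDContract X θ Y).1 ρ

/-- The presymplectic structure determined by `L` and `θ`: the element `Ω` of
`E_1^{2, n - 1}(𝓔)` that `dl` gives rise to, where `l` is the restriction of `L + θ` to `𝓔`. -/
def IsPresymplectic (S : Set (Jet n m V)) (L θ : JetForms n m V n) (Ω : VinE S 1 2 (n + 1)) :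
    Prop :=
  IsClassOf _ _ (dOn (vanishingIdeal S) n (restrictForm (vanishingIdeal S) n (L + θ))) Ω

end Bundle

end JetGeom

set_option linter.unusedSectionVars false

/-! The theorem combines one homological fact with one pointwise computation.

Homological part. Let `F` be the Cartan filtration and l = L + θ on 𝓔, where θ is the form ω_L.
Since θ ∈ F¹ and every (n+1)-form lies in F¹, the forms L and l have the same class in E₁. If this
class, or the class of l in E₂, were zero, then l = c + db with c ∈ F¹, so dl = dc. As dl ∈ F², the
form c gives an element of E₁^{1,n-1} whose image under d₁ is the class of dl, and that class dies
in E₂^{2,n-1}. This is `represents_and_ne_zero_of_d_mem`.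

Pointwise part (`inCartanPowAt_two_extD`). At a jet ρ where E(L) = 0, d(L + θ) must vanish as soon
as n of its n + 1 arguments lie in the Cartan plane. By antisymmetry the remaining argument may come
first; split it into a Cartan vector and a vertical one. The Cartan vector contributes nothing,
because n + 1 vectors of an n-dimensional plane are dependent. The vertical one is realised by the
evolutionary field E_τ of a section τ of the bundle itself, and the Cartan arguments by lifts Y_a of
cut-off fields on M. Adding ετ to a section commutes with differentiating along the base, so [E_τ,
Y_a] = 0. As θ is zero on Cartan fields, 𝓛_{E_τ}θ is zero on the Y_a; as L is horizontal, E_τ ⌟ L =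
0. Cartan's formula leaves 𝓛_{E_τ}L − d(E_τ ⌟ θ), which by the Noether identity is ⟨E(L), τ⟩ = 0 at
ρ (`evalAt_extD_translationField_cons`).

Vector fields are abstract derivations, so the splitting has to be proved. Hadamard's lemma gives
derivations a chain rule, hence a tangent vector is determined on each function by finitely many
coordinates (`exists_derivation_formula`). A form involves only finitely many functions
(`exists_finset_of_mem_forms`), so τ needs only a prescribed jet of finite order, which polynomials
provide (`exists_decomposition`). -/

namespace DiffCalc

/-! ### Forms as finite sums of determinants -/

section FormsAlgebra

variable {A : Type*} [CommRing A] [Algebra ℝ A]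

theorem exists_sum_of_mem_forms {k : ℕ} {θ : Cochain A k} (h : θ ∈ Forms A k) :
    ∃ (N : ℕ) (f : Fin N → A) (g : Fin N → Fin k → A), θ = ∑ i, f i • wedgeD (g i) := by
  obtain ⟨N, f, g, rfl⟩ := Submodule.mem_span_set'.1 h
  choose g' hg' using fun i => (g i).2
  exact ⟨N, f, g', by simp [hg']⟩

/-- A ring homomorphism commutes with determinants. With evaluation at a jet as `ev`, statements
about the value of a form become statements about real matrices. -/
theorem map_sum_smul_wedgeD {B : Type*} [CommRing B] (ev : A →+* B) {k N : ℕ} (f : Fin N → A)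
    (g : Fin N → Fin k → A) (X : Fin k → Derivation ℝ A A) :
    ev ((∑ i, f i • wedgeD (g i)) X) =
      ∑ i, ev (f i) * (Matrix.of fun a b => ev (X a (g i b))).det := by
  simp only [Finset.sum_apply, Pi.smul_apply, smul_eq_mul, map_sum, map_mul, wedgeD,
    RingHom.map_det]
  rfl

/-- The value of a form at a point depends only on the values there of the arguments on finitely
many functions, and additively on the first argument. -/
theorem exists_finset_of_mem_forms {k : ℕ} {θ : Cochain A k} (h : θ ∈ Forms A k) :
    ∃ T : Finset A, ∀ {B : Type} [CommRing B] (ev : A →+* B),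
      (∀ X X' : Fin k → Derivation ℝ A A, (∀ a, ∀ t ∈ T, ev (X a t) = ev (X' a t)) →
        ev (θ X) = ev (θ X')) ∧
      ∀ (X Y Z : Fin k → Derivation ℝ A A) (i : Fin k),
        (∀ j, j ≠ i → X j = Y j ∧ X j = Z j) → (∀ t ∈ T, ev (X i t) = ev (Y i t) + ev (Z i t)) →
        ev (θ X) = ev (θ Y) + ev (θ Z) := by
  classical
  obtain ⟨N, f, g, rfl⟩ := exists_sum_of_mem_forms h
  -- `T` collects all functions whose differentials occur in one expression of the form.
  refine ⟨Finset.univ.biUnion fun i => Finset.univ.image (g i), fun ev => ?_⟩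
  have hT : ∀ i b, g i b ∈ Finset.univ.biUnion fun i => Finset.univ.image (g i) := fun i b => by
    simp
  refine ⟨fun X X' hX => ?_, fun X Y Z j hj hX => ?_⟩
  · simp only [map_sum_smul_wedgeD, hX _ _ (hT _ _)]
  · simp only [map_sum_smul_wedgeD, ← Finset.sum_add_distrib, ← mul_add]
    refine Finset.sum_congr rfl fun i _ => ?_
    congr 1
    -- The matrices for `X`, `Y` and `Z` differ only in row `j`, in which the determinant is
    -- additive.
    have hM : ∀ W : Fin k → Derivation ℝ A A, (∀ a, a ≠ j → X a = W a) →
        (Matrix.of fun a b => ev (W a (g i b))) =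
          (Matrix.of fun a b => ev (X a (g i b))).updateRow j fun b => ev (W j (g i b)) := by
      intro W hW
      ext a b
      by_cases ha : a = j
      · subst ha; simp
      · simp [Matrix.updateRow_ne ha, hW a ha]
    rw [hM Y fun a ha => (hj a ha).1, hM Z fun a ha => (hj a ha).2, ← Matrix.det_updateRow_add]
    congr 1
    ext a b
    by_cases ha : a = j
    · subst ha; simp [hX _ (hT _ _)]
    · simp [Matrix.updateRow_ne ha]

theorem forms_apply_comp_perm {k : ℕ} {θ : Cochain A k} (h : θ ∈ Forms A k)
    (X : Fin k → Derivation ℝ A A) (σ : Equiv.Perm (Fin k)) :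
    θ (X ∘ σ) = ((Equiv.Perm.sign σ : ℤ) : A) * θ X := by
  obtain ⟨N, f, g, rfl⟩ := exists_sum_of_mem_forms h
  have := map_sum_smul_wedgeD (RingHom.id A) f g
  simp only [RingHom.id_apply] at this
  rw [this, this, Finset.mul_sum]
  refine Finset.sum_congr rfl fun i _ => ?_
  rw [mul_left_comm]
  congr 1
  exact Matrix.det_permute σ (Matrix.of fun a b => X a (g i b))

theorem forms_apply_eq_zero {k : ℕ} {θ : Cochain A k} (h : θ ∈ Forms A k)
    (X : Fin k → Derivation ℝ A A) (i : Fin k) (hX : X i = 0) : θ X = 0 := by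
  obtain ⟨N, f, g, rfl⟩ := exists_sum_of_mem_forms h
  have := map_sum_smul_wedgeD (RingHom.id A) f g
  simp only [RingHom.id_apply] at this
  rw [this]
  refine Finset.sum_eq_zero fun j _ => ?_
  rw [Matrix.det_eq_zero_of_row_eq_zero i (by simp [hX]), mul_zero]

/-- The coefficients `c` give a linear relation between the rows of every determinant in the
expression of the form. -/
theorem forms_apply_eq_zero_of_dependent {k : ℕ} {θ : Cochain A k} (h : θ ∈ Forms A k)
    (ev : A →+* ℝ) (X : Fin k → Derivation ℝ A A) (c : Fin k → ℝ) (hc : c ≠ 0)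
    (hX : ∀ t, ∑ a, c a * ev (X a t) = 0) : ev (θ X) = 0 := by
  obtain ⟨N, f, g, rfl⟩ := exists_sum_of_mem_forms h
  rw [map_sum_smul_wedgeD]
  refine Finset.sum_eq_zero fun i _ => ?_
  rw [(Matrix.exists_vecMul_eq_zero_iff (M := Matrix.of fun a b => ev (X a (g i b)))).1
    ⟨c, hc, ?_⟩, mul_zero]
  ext b
  exact hX _

end FormsAlgebra

/-! ### Nontrivial classes in the spectral sequence of a filtered complex -/

section SpectralSequence

variable {C : ℕ → Type*} [∀ k, AddCommGroup (C k)] [∀ k, Module ℝ (C k)]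
  {d : ∀ k, C k →ₗ[ℝ] C (k + 1)} {F : ℕ → ∀ k, Submodule ℝ (C k)}

theorem mk_eq_mk_iff {r p k : ℕ} {z w : C k} (hz : z ∈ cyc d F r p k) (hw : w ∈ cyc d F r p k) :
    (Submodule.Quotient.mk ⟨z, hz⟩ : Page d F r p k) = Submodule.Quotient.mk ⟨w, hw⟩ ↔
      z - w ∈ bnd d F r p k := by
  rw [Submodule.Quotient.eq]; rfl

theorem mk_eq_zero_iff {r p k : ℕ} {z : C k} (hz : z ∈ cyc d F r p k) :
    (Submodule.Quotient.mk ⟨z, hz⟩ : Page d F r p k) = 0 ↔ z ∈ bnd d F r p k := by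
  rw [Submodule.Quotient.mk_eq_zero]; rfl

/-- If `l` is exact modulo `F¹` up to cochains with differential in `F²`, then `dl` is the
differential of an element of `F¹`. -/
theorem exists_d_eq_of_mem_bnd {r n : ℕ} (hd : ∀ k x, d (k + 1) (d k x) = 0) {l : C n}
    (hl : l ∈ bnd d F r 0 n) : ∃ c ∈ F 1 n, d n l = d n c := by
  cases n with
  | zero => exact ⟨l, hl.1, rfl⟩
  | succ n =>
    obtain ⟨c, hc, _, ⟨_, b, _, rfl⟩, rfl⟩ := Submodule.mem_sup.1 hl
    exact ⟨c, hc.1, by rw [map_add, hd, add_zero]⟩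

/-- Such a `c` would represent an element of the column p = 1 of E₁ that d₁ sends to `Ω`, so that
`Ω` would be zero in E₂. -/
theorem class_ne_zero_of_d_class_ne_zero (hd : ∀ k x, d (k + 1) (d k x) = 0)
    (hF : ∀ p k, F (p + 1) k ≤ F p k) {n : ℕ} {l : C n}
    {Ω : Page d F 1 2 (n + 1)} {e : Page d F 2 2 (n + 1)} (hΩ : IsClassOf d F (d n l) Ω)
    (he : Represents d F Ω e) (he0 : e ≠ 0) {c : C n} (hc : c ∈ F 1 n) : d n l ≠ d n c := by
  intro hlc
  obtain ⟨hl, rfl⟩ := hΩ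
  obtain ⟨z, ⟨hz1, h⟩, hz2, rfl⟩ := he
  refine he0 ((mk_eq_zero_iff hz2).2 ?_)
  obtain ⟨a, ha, _, ⟨_, b, hb, rfl⟩, hab⟩ := Submodule.mem_sup.1 ((mk_eq_mk_iff hz1 hl).1 h.symm)
  -- This is a decomposition as required by `bnd` on page 2: there the exact part may come from
  -- F^{2+1-2} = F¹, which contains both `b` and `c`. The condition da ∈ F⁴ comes from dz = da.
  have hz : z = a + d n (b + c) := by
    rw [map_add, ← hlc, ← add_assoc, hab, sub_add_cancel]
  have hda : d (n + 1) z = d (n + 1) a := by rw [hz, map_add, hd, add_zero]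
  refine Submodule.mem_sup.2 ⟨a, ⟨ha.1, ?_⟩, d n (b + c), ⟨?_, b + c, ?_, rfl⟩, hz.symm⟩
  · exact (show d (n + 1) a ∈ F (2 + 2) (n + 1 + 1) from hda ▸ hz2.2)
  · rw [← sub_eq_iff_eq_add'.2 hz]
    exact Submodule.sub_mem _ hz2.1 (hF _ _ ha.1)
  · exact Submodule.add_mem _ (hF _ _ hb) hc

/-- On E₀ the representative is `L`, but on E₂ it must be `L + θ`, whose differential is in F². The
two agree on E₁ because `θ` is in F¹ and so is every cochain of the next degree. -/
theorem represents_and_ne_zero_of_d_mem (hd : ∀ k x, d (k + 1) (d k x) = 0)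
    (hF : ∀ p k, F (p + 1) k ≤ F p k) {n : ℕ} (hF0 : F 0 n = ⊤) (hF0' : F 0 (n + 1) = ⊤)
    (hF1 : F 1 (n + 1) = ⊤) {L θ : C n} (hθ : θ ∈ F 1 n) (hl : d n (L + θ) ∈ F 2 (n + 1)) :
    (∃ (Ω : Page d F 1 2 (n + 1)) (e : Page d F 2 2 (n + 1)),
      IsClassOf d F (d n (L + θ)) Ω ∧ pageD d F hd 1 2 (n + 1) Ω = 0 ∧ Represents d F Ω e) ∧
    ∀ (Ω : Page d F 1 2 (n + 1)) (e : Page d F 2 2 (n + 1)),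
      IsClassOf d F (d n (L + θ)) Ω → Represents d F Ω e → e ≠ 0 →
        ∃ (e₀ : Page d F 0 0 n) (e₁ : Page d F 1 0 n) (e₂ : Page d F 2 0 n),
          IsClassOf d F L e₀ ∧ Represents d F e₀ e₁ ∧ e₁ ≠ 0 ∧
          Represents d F e₁ e₂ ∧ e₂ ≠ 0 := by
  have hcyc : ∀ r, d n (L + θ) ∈ cyc d F r 2 (n + 1) := fun r =>
    ⟨hl, by simp [hd]⟩
  refine ⟨⟨Submodule.Quotient.mk ⟨_, hcyc 1⟩, Submodule.Quotient.mk ⟨_, hcyc 2⟩, ⟨_, rfl⟩, ?_,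
    _, ⟨_, rfl⟩, ⟨_, rfl⟩⟩, fun Ω e hΩ he he0 => ?_⟩
  · refine (Submodule.mapQ_apply _ _ _ _).trans ((Submodule.Quotient.mk_eq_zero _).2 ?_)
    change d (n + 1) (d n (L + θ)) ∈ bnd d F 1 (2 + 1) (n + 1 + 1)
    rw [hd]; exact Submodule.zero_mem _
  · have hL0 : L ∈ cyc d F 0 0 n := ⟨by simp [hF0], by simp [hF0']⟩
    have hL1 : L ∈ cyc d F 1 0 n := ⟨by simp [hF0], by simp [hF1]⟩
    have hl1 : L + θ ∈ cyc d F 1 0 n := ⟨by simp [hF0], by simp [hF1]⟩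
    have hl2 : L + θ ∈ cyc d F 2 0 n := ⟨by simp [hF0], by simpa using hl⟩
    have key := fun c (hc : c ∈ F 1 n) => class_ne_zero_of_d_class_ne_zero hd hF hΩ he he0 hc
    have hθb : θ ∈ bnd d F 1 0 n := by
      have h : θ ∈ F (0 + 1) n ⊓ (F (0 + 1) (n + 1)).comap (d n) := ⟨hθ, by simp [hF1]⟩
      cases n with
      | zero => exact h
      | succ n => exact Submodule.mem_sup_left h
    have hLl : (Submodule.Quotient.mk ⟨L, hL1⟩ : Page d F 1 0 n) =
        Submodule.Quotient.mk ⟨L + θ, hl1⟩ :=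
      (mk_eq_mk_iff hL1 hl1).2 (by simpa using hθb)
    refine ⟨Submodule.Quotient.mk ⟨L, hL0⟩, Submodule.Quotient.mk ⟨L, hL1⟩,
      Submodule.Quotient.mk ⟨L + θ, hl2⟩, ⟨_, rfl⟩, ⟨L, ⟨_, rfl⟩, ⟨_, rfl⟩⟩, fun h => ?_,
      ⟨L + θ, ⟨hl1, hLl⟩, ⟨_, rfl⟩⟩, fun h => ?_⟩
    · obtain ⟨c, hc, h'⟩ := exists_d_eq_of_mem_bnd hd ((mk_eq_zero_iff hl1).1 (hLl ▸ h))
      exact key c hc h'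
    · obtain ⟨c, hc, h'⟩ := exists_d_eq_of_mem_bnd hd ((mk_eq_zero_iff hl2).1 h)
      exact key c hc h'

end SpectralSequence

end DiffCalc

namespace JetGeom

/-! ### Smooth dependence of integrals, Hadamard's lemma, symmetry of second derivatives -/

section Calculus

/-- Differentiation under the integral sign gives an integral of the same kind, with values in a
space of linear maps; the target is therefore generalised in the induction. Compactness of a closed
ball times [0, 1] gives the dominating constant. -/
theorem contDiff_nat_intervalIntegral {P : Type} [NormedAddCommGroup P] [NormedSpace ℝ P]
    [ProperSpace P] (N : ℕ) : ∀ {F : Type} [NormedAddCommGroup F] [NormedSpace ℝ F]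
    {Φ : P × ℝ → F}, ContDiff ℝ ∞ Φ → ContDiff ℝ N fun x => ∫ t in (0 : ℝ)..1, Φ (x, t) := by
  induction N with
  | zero =>
    intro F _ _ Φ hΦ
    exact contDiff_zero.2 (intervalIntegral.continuous_parametric_intervalIntegral_of_continuous'
      (f := fun x t => Φ (x, t)) (by simpa [Function.uncurry_def] using hΦ.continuous) 0 1)
  | succ N ih =>
    intro F _ _ Φ hΦ
    have hΨ : ContDiff ℝ ∞ fun q : P × ℝ =>
        (fderiv ℝ Φ q).comp (ContinuousLinearMap.inl ℝ P ℝ) :=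
      (hΦ.fderiv_right (m := ∞) (by simp)).clm_comp contDiff_const
    rw [show ((N + 1 : ℕ) : WithTop ℕ∞) = (N : WithTop ℕ∞) + 1 by push_cast; rfl,
      contDiff_succ_iff_hasFDerivAt]
    refine ⟨_, ih hΨ, fun x => ?_⟩
    obtain ⟨C, hC⟩ := ((isCompact_closedBall x 1).prod
      (isCompact_Icc (a := (0 : ℝ)) (b := 1))).exists_bound_of_continuousOn
      hΨ.continuous.continuousOn
    have hcont : ∀ y, Continuous fun t => Φ (y, t) := fun y =>
      hΦ.continuous.comp (by fun_prop)
    refine intervalIntegral.hasFDerivAt_integral_of_dominated_of_fderiv_le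
      (F := fun x t => Φ (x, t)) (bound := fun _ => C) (Metric.closedBall_mem_nhds x one_pos)
      (Filter.Eventually.of_forall fun y => (hcont y).aestronglyMeasurable)
      ((hcont x).intervalIntegrable _ _)
      (hΨ.continuous.comp (by fun_prop : Continuous fun t : ℝ => (x, t))).aestronglyMeasurable
      (Filter.Eventually.of_forall fun t ht y hy => hC (y, t) ⟨hy, ?_⟩)
      (by simp) (Filter.Eventually.of_forall fun t _ y _ => ?_)
    · rw [Set.uIoc_of_le zero_le_one] at ht
      exact ⟨ht.1.le, ht.2⟩
    · have h1 := (hΦ.differentiable (by simp) (y, t)).hasFDerivAt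
      have h2 : HasFDerivAt (fun y : P => (y, t)) (ContinuousLinearMap.inl ℝ P ℝ) y :=
        hasFDerivAt_prodMk_left y t
      exact h1.comp y h2

/-- Hadamard's lemma. -/
theorem exists_hadamard {ι : Type} [Fintype ι] {H : (ι → ℝ) → ℝ} (hH : ContDiff ℝ ∞ H)
    (z₀ : ι → ℝ) : ∃ h : ι → (ι → ℝ) → ℝ, (∀ i, ContDiff ℝ ∞ (h i)) ∧
      ∀ z, H z = H z₀ + ∑ i, (z i - z₀ i) * h i z := by
  classical
  have hsm : ∀ i, ContDiff ℝ ∞ fun q : (ι → ℝ) × ℝ =>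
      fderiv ℝ H (z₀ + q.2 • (q.1 - z₀)) (Pi.single i 1) := fun i =>
    ((hH.fderiv_right (m := ∞) (by simp)).comp (by fun_prop)).clm_apply contDiff_const
  -- The coefficient is the mean of ∂ᵢH over the segment from z₀ to z, and the expansion is the
  -- fundamental theorem of calculus along that segment.
  refine ⟨fun i z => ∫ t in (0 : ℝ)..1, fderiv ℝ H (z₀ + t • (z - z₀)) (Pi.single i 1),
    fun i => contDiff_infty.2 fun N => contDiff_nat_intervalIntegral N (hsm i), fun z => ?_⟩
  have hd : ∀ t : ℝ, HasDerivAt (fun t : ℝ => H (z₀ + t • (z - z₀)))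
      (∑ i, (z i - z₀ i) * fderiv ℝ H (z₀ + t • (z - z₀)) (Pi.single i 1)) t := by
    intro t
    have h1 := (hH.differentiable (by simp) (z₀ + t • (z - z₀))).hasFDerivAt
    have h2 : HasDerivAt (fun t : ℝ => z₀ + t • (z - z₀)) (z - z₀) t := by
      simpa using ((hasDerivAt_id t).smul_const (z - z₀)).const_add z₀
    convert! h1.comp_hasDerivAt t h2 using 1
    rw [congrArg (fderiv ℝ H (z₀ + t • (z - z₀))) (pi_eq_sum_univ' (z - z₀)), map_sum]
    refine Finset.sum_congr rfl fun i _ => ?_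
    rw [map_smul, smul_eq_mul, Pi.sub_apply]
  have hc : ∀ i, Continuous fun t : ℝ =>
      (z i - z₀ i) * fderiv ℝ H (z₀ + t • (z - z₀)) (Pi.single i 1) := fun i =>
    continuous_const.mul ((hsm i).continuous.comp (by fun_prop : Continuous fun t : ℝ => (z, t)))
  have := intervalIntegral.integral_eq_sub_of_hasDerivAt (a := 0) (b := 1) (fun t _ => hd t)
    ((continuous_finsetSum _ fun i _ => hc i).intervalIntegrable _ _)
  rw [intervalIntegral.integral_finsetSum fun i _ => (hc i).intervalIntegrable _ _] at this
  simp only [intervalIntegral.integral_const_mul, one_smul, zero_smul, add_zero,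
    add_sub_cancel] at this
  rw [this]; ring

theorem lineDeriv_eq_fderiv_of_contDiffOn {P : Type*} [NormedAddCommGroup P] [NormedSpace ℝ P] {O : Set P}
    (hO : IsOpen O) {Φ : P → ℝ} (hΦ : ContDiffOn ℝ ∞ Φ O) {p : P} (hp : p ∈ O) (a : P) :
    lineDeriv ℝ Φ p a = fderiv ℝ Φ p a :=
  ((hΦ.contDiffAt (hO.mem_nhds hp)).differentiableAt (by simp)).lineDeriv_eq_fderiv

theorem contDiffOn_fderiv_apply_const {P F : Type*} [NormedAddCommGroup P] [NormedSpace ℝ P]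
    [NormedAddCommGroup F] [NormedSpace ℝ F] {O : Set P}
    (hO : IsOpen O) {Φ : P → F} (hΦ : ContDiffOn ℝ ∞ Φ O) (a : P) :
    ContDiffOn ℝ ∞ (fun q => fderiv ℝ Φ q a) O :=
  (hΦ.fderiv_of_isOpen hO (by simp)).clm_apply contDiffOn_const

theorem fderiv_fderiv_comm {P : Type*} [NormedAddCommGroup P] [NormedSpace ℝ P] {O : Set P}
    (hO : IsOpen O) {Φ : P → ℝ} (hΦ : ContDiffOn ℝ ∞ Φ O) {p : P} (hp : p ∈ O) (a b : P) :
    fderiv ℝ (fun q => fderiv ℝ Φ q a) p b = fderiv ℝ (fun q => fderiv ℝ Φ q b) p a := by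
  have hd : DifferentiableAt ℝ (fderiv ℝ Φ) p :=
    ((hΦ.fderiv_of_isOpen hO (m := ∞) (by simp)).contDiffAt (hO.mem_nhds hp)).differentiableAt
      (by simp)
  have hs := (hΦ.contDiffAt (hO.mem_nhds hp)).isSymmSndFDerivAt (by
    simpa using (mod_cast le_top : ((2 : ℕ∞) : WithTop ℕ∞) ≤ ∞))
  have : ∀ c d : P, fderiv ℝ (fun q => fderiv ℝ Φ q c) p d = fderiv ℝ (fderiv ℝ Φ) p d c := by
    intro c d
    rw [fderiv_clm_apply hd (differentiableAt_const c)]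
    simp
  rw [this, this, hs.eq]

end Calculus

/-! ### Iterated partial derivatives on the base -/

section BasePartial

variable {n : ℕ}

local notation "𝔼" => EuclideanSpace ℝ (Fin n)

theorem iterOps_eq_foldr {β : Type*} (T : Fin n → β → β) (α : Fin n → ℕ) (b : β) :
    iterOps T α b = (List.finRange n).foldr (fun j c => (T j)^[α j] c) b := by
  rw [iterOps, List.ofFn_eq_map, List.foldr_map]

/-- A relation preserved by each operator is preserved by their composites. -/
theorem iterOps_rel {β γ : Type*} {T : Fin n → β → β} {T' : Fin n → γ → γ} (R : β → γ → Prop)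
    (hR : ∀ j b c, R b c → R (T j b) (T' j c)) (α : Fin n → ℕ) {b : β} {c : γ} (h : R b c) :
    R (iterOps T α b) (iterOps T' α c) := by
  have hit : ∀ j k b c, R b c → R ((T j)^[k] b) ((T' j)^[k] c) := by
    intro j k
    induction k with
    | zero => exact fun b c h => h
    | succ k ih =>
      intro b c h
      rw [Function.iterate_succ_apply', Function.iterate_succ_apply']
      exact hR _ _ _ (ih _ _ h)
  rw [iterOps_eq_foldr, iterOps_eq_foldr]
  induction List.finRange n with
  | nil => exact h
  | cons j l ih => exact hit _ _ _ _ ih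

theorem iterOps_zero {β : Type*} (T : Fin n → β → β) (b : β) : iterOps T 0 b = b := by
  rw [iterOps_eq_foldr]
  induction List.finRange n with
  | nil => rfl
  | cons j l ih => simp

variable {O : Set (EuclideanSpace ℝ (Fin n))}

theorem basePartial_eq_fderiv (hO : IsOpen O) {h : 𝔼 → ℝ} (hh : ContDiffOn ℝ ∞ h O) {y : 𝔼}
    (hy : y ∈ O) (j : Fin n) :
    basePartial j h y = fderiv ℝ h y (EuclideanSpace.single j 1) :=
  lineDeriv_eq_fderiv_of_contDiffOn hO hh hy _

theorem basePartial_congr (hO : IsOpen O) {h h' : 𝔼 → ℝ} (hh : Set.EqOn h h' O) (j : Fin n) :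
    Set.EqOn (basePartial j h) (basePartial j h') O := fun _ hy =>
  (hh.eventuallyEq_of_mem (hO.mem_nhds hy)).lineDeriv_eq

theorem contDiffOn_basePartial (hO : IsOpen O) {h : 𝔼 → ℝ} (hh : ContDiffOn ℝ ∞ h O)
    (j : Fin n) : ContDiffOn ℝ ∞ (basePartial j h) O :=
  (contDiffOn_fderiv_apply_const hO hh _).congr fun _ hy => basePartial_eq_fderiv hO hh hy j

theorem contDiffOn_iterOps_basePartial (hO : IsOpen O) {h : 𝔼 → ℝ} (hh : ContDiffOn ℝ ∞ h O)
    (α : Fin n → ℕ) : ContDiffOn ℝ ∞ (iterOps basePartial α h) O :=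
  iterOps_rel (T' := basePartial) (fun h (_ : 𝔼 → ℝ) => ContDiffOn ℝ ∞ h O)
    (fun j _ _ h => contDiffOn_basePartial hO h j) α (c := h) hh

theorem iterOps_basePartial_congr (hO : IsOpen O) {h h' : 𝔼 → ℝ} (hh : Set.EqOn h h' O)
    (α : Fin n → ℕ) : Set.EqOn (iterOps basePartial α h) (iterOps basePartial α h') O :=
  iterOps_rel (fun h h' => Set.EqOn h h' O) (fun j _ _ h => basePartial_congr hO h j) α hh

theorem iterOps_basePartial_add_smul (hO : IsOpen O) {h h' : 𝔼 → ℝ} (hh : ContDiffOn ℝ ∞ h O)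
    (hh' : ContDiffOn ℝ ∞ h' O) (c : ℝ) (α : Fin n → ℕ) :
    Set.EqOn (iterOps basePartial α fun y => h y + c * h' y)
      (fun y => iterOps basePartial α h y + c * iterOps basePartial α h' y) O := by
  -- Differentiating pairs turns a relation between three functions into one between two objects, to
  -- which `iterOps_rel` applies.
  let T : Fin n → (𝔼 → ℝ) × (𝔼 → ℝ) → (𝔼 → ℝ) × (𝔼 → ℝ) := fun j p =>
    (basePartial j p.1, basePartial j p.2)
  have hT1 : (iterOps T α (h, h')).1 = iterOps basePartial α h :=
    iterOps_rel (T := T) (fun p a => p.1 = a) (fun j p a e => by simp [T, e]) α rfl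
  have hT2 : (iterOps T α (h, h')).2 = iterOps basePartial α h' :=
    iterOps_rel (T := T) (fun p a => p.2 = a) (fun j p a e => by simp [T, e]) α rfl
  have := iterOps_rel (T := T) (T' := basePartial)
    (fun p a => ContDiffOn ℝ ∞ p.1 O ∧ ContDiffOn ℝ ∞ p.2 O ∧
      Set.EqOn a (fun y => p.1 y + c * p.2 y) O)
    (fun j p a ⟨h1, h2, h3⟩ => ⟨contDiffOn_basePartial hO h1 j, contDiffOn_basePartial hO h2 j,
      fun y hy => by
        rw [basePartial_congr hO h3 j hy, basePartial_eq_fderiv hO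
          (h1.add (contDiffOn_const.mul h2)) hy]
        have d1 := (h1.contDiffAt (hO.mem_nhds hy)).differentiableAt (by simp)
        have d2 := (h2.contDiffAt (hO.mem_nhds hy)).differentiableAt (by simp)
        simp only [T]
        rw [basePartial_eq_fderiv hO h1 hy, basePartial_eq_fderiv hO h2 hy,
          fderiv_fun_add d1 (d2.const_mul c), fderiv_const_mul d2]
        simp⟩) α (b := (h, h')) (c := fun y => h y + c * h' y) ⟨hh, hh', fun _ _ => rfl⟩
  intro y hy
  rw [this.2.2 hy, hT1, hT2]

theorem basePartial_comm (hO : IsOpen O) {h : 𝔼 → ℝ} (hh : ContDiffOn ℝ ∞ h O) (i j : Fin n) :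
    Set.EqOn (basePartial i (basePartial j h)) (basePartial j (basePartial i h)) O := by
  have key : ∀ i j : Fin n, ∀ y ∈ O, basePartial i (basePartial j h) y =
      fderiv ℝ (fun q => fderiv ℝ h q (EuclideanSpace.single j 1)) y
        (EuclideanSpace.single i 1) := by
    intro i j y hy
    rw [basePartial_congr hO (fun z hz => basePartial_eq_fderiv hO hh hz j) i hy,
      basePartial_eq_fderiv hO (contDiffOn_fderiv_apply_const hO hh _) hy]
  intro y hy
  rw [key i j y hy, key j i y hy, fderiv_fderiv_comm hO hh hy]

/-- Partial derivatives of smooth functions commute, so the extra ∂ⱼ, which `iterOps` places inside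
the j-th block, can be moved to the outside. -/
theorem iterOps_basePartial_add_single (hO : IsOpen O) {h : 𝔼 → ℝ} (hh : ContDiffOn ℝ ∞ h O)
    (α : Fin n → ℕ) (j : Fin n) :
    Set.EqOn (iterOps basePartial (α + Pi.single j 1) h)
      (basePartial j (iterOps basePartial α h)) O := by
  have hsm : ∀ (k : Fin n) (a : ℕ) (g : 𝔼 → ℝ), ContDiffOn ℝ ∞ g O →
      ContDiffOn ℝ ∞ ((basePartial k)^[a] g) O := by
    intro k a g hg
    induction a with
    | zero => exact hg
    | succ a ih => rw [Function.iterate_succ_apply']; exact contDiffOn_basePartial hO ih k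
  have hcg : ∀ (k : Fin n) (a : ℕ) (g g' : 𝔼 → ℝ), Set.EqOn g g' O →
      Set.EqOn ((basePartial k)^[a] g) ((basePartial k)^[a] g') O := by
    intro k a g g' hg
    induction a with
    | zero => exact hg
    | succ a ih =>
      rw [Function.iterate_succ_apply', Function.iterate_succ_apply']
      exact basePartial_congr hO ih k
  have hcm : ∀ (k : Fin n) (a : ℕ) (g : 𝔼 → ℝ), ContDiffOn ℝ ∞ g O →
      Set.EqOn ((basePartial k)^[a] (basePartial j g)) (basePartial j ((basePartial k)^[a] g)) O := by
    intro k a g hg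
    induction a with
    | zero => exact fun _ _ => rfl
    | succ a ih =>
      rw [Function.iterate_succ_apply', Function.iterate_succ_apply']
      exact (basePartial_congr hO ih k).trans (basePartial_comm hO (hsm k a g hg) k j)
  let fold : (Fin n → ℕ) → List (Fin n) → 𝔼 → ℝ := fun α l =>
    l.foldr (fun j c => (basePartial j)^[α j] c) h
  have hfsm : ∀ l, ContDiffOn ℝ ∞ (fold α l) O := by
    intro l
    induction l with
    | nil => exact hh
    | cons k l ih => exact hsm _ _ _ ih
  have hfn : ∀ l, j ∉ l → fold (α + Pi.single j 1) l = fold α l := by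
    intro l hl
    induction l with
    | nil => rfl
    | cons k l ih =>
      simp only [List.mem_cons, not_or] at hl
      change (basePartial k)^[(α + Pi.single j 1 : Fin n → ℕ) k] (fold (α + Pi.single j 1) l) =
        (basePartial k)^[α k] (fold α l)
      rw [ih hl.2, Pi.add_apply, Pi.single_eq_of_ne (Ne.symm hl.1), add_zero]
  have key : ∀ l : List (Fin n), l.Nodup → j ∈ l →
      Set.EqOn (fold (α + Pi.single j 1) l) (basePartial j (fold α l)) O := by
    intro l hl hj
    induction l with
    | nil => simp at hj
    | cons k l ih =>
      rw [List.nodup_cons] at hl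
      change Set.EqOn ((basePartial k)^[(α + Pi.single j 1 : Fin n → ℕ) k] (fold (α + Pi.single j 1) l))
        (basePartial j ((basePartial k)^[α k] (fold α l))) O
      by_cases hkj : j = k
      · subst hkj
        rw [hfn l hl.1, Pi.add_apply, Pi.single_eq_same, Function.iterate_succ_apply']
        exact fun _ _ => rfl
      · rw [Pi.add_apply, Pi.single_eq_of_ne (Ne.symm hkj), add_zero]
        have hj' : j ∈ l := by simpa [hkj] using hj
        exact (hcg k _ _ _ (ih hl.2 hj')).trans (hcm k _ _ (hfsm l))
  rw [iterOps_eq_foldr, iterOps_eq_foldr]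
  exact key _ (List.nodup_finRange n) (List.mem_finRange j)

/-- Products of one-variable polynomials are stable under partial derivatives, which makes all their
iterated derivatives computable. -/
theorem basePartial_prod_eval (p : Fin n → Polynomial ℝ) (j : Fin n) :
    basePartial j (fun y : 𝔼 => ∏ i, (p i).eval (y i)) =
      fun y => ∏ i, (Function.update p j (Polynomial.derivative (p j)) i).eval (y i) := by
  funext y
  have h : ∀ t : ℝ, ∏ i, (p i).eval ((y + t • EuclideanSpace.single j (1 : ℝ)) i) =
      (p j).eval (y j + t) * ∏ i ∈ Finset.univ.erase j, (p i).eval (y i) := by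
    intro t
    rw [← Finset.mul_prod_erase _ _ (Finset.mem_univ j)]
    congr 1
    · simp
    · refine Finset.prod_congr rfl fun i hi => ?_
      simp [Finset.ne_of_mem_erase hi]
  have hd : HasDerivAt (fun t : ℝ => (p j).eval (y j + t))
      ((Polynomial.derivative (p j)).eval (y j)) 0 := by
    simpa using (p j).hasDerivAt (y j + 0) |>.comp_const_add (y j) 0
  rw [basePartial, lineDeriv]
  simp only [h]
  rw [(hd.mul_const _).deriv, ← Finset.mul_prod_erase Finset.univ
    (fun i => (Function.update p j (Polynomial.derivative (p j)) i).eval (y i))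
    (Finset.mem_univ j), Function.update_self]
  congr 1
  refine Finset.prod_congr rfl fun i hi => ?_
  rw [Function.update_of_ne (Finset.ne_of_mem_erase hi)]

theorem iterOps_basePartial_prod_eval (p : Fin n → Polynomial ℝ) (α : Fin n → ℕ) :
    iterOps basePartial α (fun y : 𝔼 => ∏ i, (p i).eval (y i)) =
      fun y => ∏ i, ((Polynomial.derivative^[α i]) (p i)).eval (y i) := by
  have hit : ∀ (j : Fin n) (a : ℕ) (p : Fin n → Polynomial ℝ),
      (basePartial j)^[a] (fun y : 𝔼 => ∏ i, (p i).eval (y i)) =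
        fun y => ∏ i, (Function.update p j (Polynomial.derivative^[a] (p j)) i).eval (y i) := by
    intro j a p
    induction a with
    | zero => simp
    | succ a ih =>
      rw [Function.iterate_succ_apply', ih, basePartial_prod_eval, Function.update_idem,
        Function.update_self, Function.iterate_succ_apply']
  have key : ∀ l : List (Fin n), l.Nodup →
      l.foldr (fun j c => (basePartial j)^[α j] c) (fun y : 𝔼 => ∏ i, (p i).eval (y i)) =
        fun y => ∏ i, ((if i ∈ l then Polynomial.derivative^[α i] (p i) else p i)).eval (y i) := by
    intro l hl
    induction l with
    | nil => simp
    | cons k l ih =>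
      rw [List.nodup_cons] at hl
      rw [List.foldr_cons, ih hl.2, hit]
      funext y
      refine Finset.prod_congr rfl fun i _ => ?_
      by_cases hik : i = k
      · subst hik; simp [hl.1]
      · simp [hik]
  rw [iterOps_eq_foldr, key _ (List.nodup_finRange n)]
  simp

/-- Borel's lemma for finitely many derivatives. -/
theorem exists_iterOps_basePartial_eq (y₀ : 𝔼) (k : ℕ) (c : (Fin n → ℕ) → ℝ) :
    ∃ h : 𝔼 → ℝ, ContDiff ℝ ∞ h ∧ ∀ α ∈ multiIdx n k, iterOps basePartial α h y₀ = c α := by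
  -- The Taylor monomial (y − y₀)^β / β! has a single nonzero derivative at y₀.
  have mono : ∀ β : Fin n → ℕ, ∃ h : 𝔼 → ℝ, ContDiff ℝ ∞ h ∧
      ∀ α, iterOps basePartial α h y₀ = if α = β then 1 else 0 := by
    intro β
    refine ⟨fun y => ∏ i, (Polynomial.C ((β i).factorial : ℝ)⁻¹ *
      (Polynomial.X - Polynomial.C (y₀ i)) ^ β i).eval (y i), ?_, fun α => ?_⟩
    · refine contDiff_prod fun i _ => ?_
      simp only [Polynomial.eval_mul, Polynomial.eval_pow, Polynomial.eval_sub, Polynomial.eval_C,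
        Polynomial.eval_X]
      fun_prop
    · rw [iterOps_basePartial_prod_eval]
      have h1 : ∀ i, (Polynomial.derivative^[α i] (Polynomial.C ((β i).factorial : ℝ)⁻¹ *
          (Polynomial.X - Polynomial.C (y₀ i)) ^ β i)).eval (y₀ i) =
            if α i = β i then 1 else 0 := by
        intro i
        rw [Polynomial.iterate_derivative_C_mul, Polynomial.iterate_derivative_X_sub_pow]
        split_ifs with h
        · rw [h]
          simp [Nat.descFactorial_self, (Nat.factorial_pos (β i)).ne']
        · rcases lt_or_gt_of_ne h with h | h
          · simp [(Nat.sub_pos_of_lt h).ne']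
          · simp [Nat.descFactorial_of_lt h]
      simp only [h1]
      split_ifs with h
      · simp [h]
      · obtain ⟨i, hi⟩ := Function.ne_iff.1 h
        exact Finset.prod_eq_zero (Finset.mem_univ i) (by simp [hi])
  choose h hh hα using mono
  have key : ∀ s : Finset (Fin n → ℕ), ∃ g : 𝔼 → ℝ, ContDiff ℝ ∞ g ∧
      ∀ α, iterOps basePartial α g y₀ = if α ∈ s then c α else 0 := by
    classical
    intro s
    induction s using Finset.induction_on with
    | empty =>
      refine ⟨fun y => 0 * h 0 y, contDiff_const.mul (hh 0), fun α => ?_⟩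
      -- Linearity with coefficient −1 shows that the iterated derivatives of the zero function
      -- vanish.
      have := iterOps_basePartial_add_smul isOpen_univ (hh 0).contDiffOn (hh 0).contDiffOn (-1) α
        (Set.mem_univ y₀)
      simpa using this
    | insert β s hβ ih =>
      obtain ⟨g, hg, hgα⟩ := ih
      refine ⟨fun y => g y + c β * h β y, hg.add (contDiff_const.mul (hh β)), fun α => ?_⟩
      refine (iterOps_basePartial_add_smul isOpen_univ hg.contDiffOn (hh β).contDiffOn _ α
        (Set.mem_univ y₀)).trans ?_
      simp only [hgα, hα]
      by_cases hαβ : α = β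
      · subst hαβ; simp [hβ]
      · simp [hαβ]
  obtain ⟨g, hg, hgα⟩ := key (multiIdx n k)
  exact ⟨g, hg, fun α hα' => by simp [hgα, hα']⟩

end BasePartial

end JetGeom

namespace JetGeom

open DiffCalc

/-! ### Functions on the jet space as functions of a point and a section -/

section JetFunctions

variable {n m : ℕ} {M : Type*} [TopologicalSpace M] [ChartedSpace (EuclideanSpace ℝ (Fin n)) M]

local notation "𝔼" => EuclideanSpace ℝ (Fin n)
local notation "ch" => chartAt (EuclideanSpace ℝ (Fin n))

section

variable (V : M → Type*) [TopologicalSpace (Bundle.TotalSpace (Fin m → ℝ) V)]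
  [∀ x, TopologicalSpace (V x)] [∀ x, AddCommGroup (V x)] [∀ x, Module ℝ (V x)]
  [FiberBundle (Fin m → ℝ) V]

variable (n m) in
/-- The range of the adapted coordinates on the base. -/
def coordDom (x₀ : M) : Set 𝔼 := ch x₀ '' adaptedDom n m V x₀

theorem adaptedDom_subset_source (x₀ : M) : adaptedDom n m V x₀ ⊆ (ch x₀).source :=
  Set.inter_subset_left

theorem isOpen_adaptedDom (x₀ : M) : IsOpen (adaptedDom n m V x₀) :=
  (ch x₀).open_source.inter (trivializationAt (Fin m → ℝ) V x₀).open_baseSet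

theorem mem_adaptedDom_self (x₀ : M) : x₀ ∈ adaptedDom n m V x₀ :=
  ⟨mem_chart_source _ x₀, FiberBundle.mem_baseSet_trivializationAt' x₀⟩

theorem isOpen_coordDom (x₀ : M) : IsOpen (coordDom n m V x₀) :=
  (ch x₀).isOpen_image_of_subset_source (isOpen_adaptedDom V x₀) (adaptedDom_subset_source V x₀)

variable {V}

theorem chart_mem_coordDom {x₀ x : M} (hx : x ∈ adaptedDom n m V x₀) :
    ch x₀ x ∈ coordDom n m V x₀ := ⟨x, hx, rfl⟩

theorem symm_mem_adaptedDom {x₀ : M} {z : 𝔼} (hz : z ∈ coordDom n m V x₀) :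
    (ch x₀).symm z ∈ adaptedDom n m V x₀ := by
  obtain ⟨x, hx, rfl⟩ := hz
  rwa [(ch x₀).left_inv hx.1]

theorem mem_target_of_mem_coordDom {x₀ : M} {z : 𝔼} (hz : z ∈ coordDom n m V x₀) :
    z ∈ (ch x₀).target := by
  obtain ⟨x, hx, rfl⟩ := hz
  exact (ch x₀).map_source hx.1

theorem chart_symm_of_mem {x₀ : M} {z : 𝔼} (hz : z ∈ coordDom n m V x₀) :
    ch x₀ ((ch x₀).symm z) = z := (ch x₀).right_inv (mem_target_of_mem_coordDom hz)

end

variable [IsManifold (𝓡 n) ∞ M]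

theorem contDiffOn_comp_chart_symm {F : Type*} [NormedAddCommGroup F] [NormedSpace ℝ F]
    {h : M → F} {U : Set M} (x₀ : M) (hU : U ⊆ (ch x₀).source)
    (hh : ContMDiffOn (𝓡 n) 𝓘(ℝ, F) ∞ h U) :
    ContDiffOn ℝ ∞ (fun z => h ((ch x₀).symm z)) (ch x₀ '' U) := by
  rw [← contMDiffOn_iff_contDiffOn]
  refine hh.comp ((contMDiffOn_chart_symm (I := 𝓡 n) (x := x₀) (n := ∞)).mono ?_) ?_
  · rintro _ ⟨x, hx, rfl⟩
    exact (ch x₀).map_source (hU hx)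
  · rintro _ ⟨x, hx, rfl⟩
    simpa [(ch x₀).left_inv (hU hx)] using hx

variable {V : M → Type*} [TopologicalSpace (Bundle.TotalSpace (Fin m → ℝ) V)]
  [∀ x, TopologicalSpace (V x)] [∀ x, AddCommGroup (V x)] [∀ x, Module ℝ (V x)]
  [FiberBundle (Fin m → ℝ) V] [VectorBundle ℝ (Fin m → ℝ) V]

/-- The `i`-th component of a section, in adapted coordinates around `x₀`. -/
noncomputable def localComp (x₀ : M) (s : Sec n m V) (i : Fin m) : 𝔼 → ℝ :=
  fun y => (trivializationAt (Fin m → ℝ) V x₀ ⟨(ch x₀).symm y, s ((ch x₀).symm y)⟩).2 i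

/-- The fibre coordinates of order at most `k` of the jets of a section. -/
noncomputable def jetVec (k : ℕ) (x₀ : M) (s : Sec n m V) (z : 𝔼) : Fin m → multiIdx n k → ℝ :=
  fun i α => iterOps basePartial α (localComp x₀ s i) z

theorem jet_base (x : M) (σ : Sec n m V) : (jet x σ).base = x := rfl

theorem exists_jet_eq (ρ : Jet n m V) : ∃ σ : Sec n m V, jet ρ.base σ = ρ := by
  obtain ⟨⟨x, σ⟩, rfl⟩ := Quotient.exists_rep ρ
  exact ⟨σ, rfl⟩

theorem jet_eq_jet_iff {x y : M} {σ τ : Sec n m V} : jet x σ = jet y τ ↔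
    x = y ∧ ∀ x₀, x ∈ adaptedDom n m V x₀ → ∀ i α,
      jetCoord n m V x₀ σ x i α = jetCoord n m V x₀ τ y i α :=
  Quotient.eq (r := jetSetoid n m V)

theorem coords_jet {x₀ x : M} (hx : x ∈ adaptedDom n m V x₀) (σ : Sec n m V) :
    (jet x σ).coords x₀ = (ch x₀ x, jetCoord n m V x₀ σ x) := by
  simp [jet, Jet.coords, hx]

theorem jetVec_eq_of_jet_eq (k : ℕ) {x₀ x : M} (hx : x ∈ adaptedDom n m V x₀) {σ τ : Sec n m V}
    (h : jet x σ = jet x τ) : jetVec k x₀ σ (ch x₀ x) = jetVec k x₀ τ (ch x₀ x) := by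
  funext i α
  exact (jet_eq_jet_iff.1 h).2 x₀ hx i α

/-- `f` is a smooth function of adapted coordinates of order at most `k`. -/
def IsOfOrder (k : ℕ) (f : M → Sec n m V → ℝ) : Prop :=
  ∀ x₀, ∃ g : 𝔼 × (Fin m → multiIdx n k → ℝ) → ℝ,
    ContDiffOn ℝ ∞ g (coordDom n m V x₀ ×ˢ Set.univ) ∧
    ∀ x ∈ adaptedDom n m V x₀, ∀ σ, f x σ = g (ch x₀ x, jetVec k x₀ σ (ch x₀ x))

/-- Every jet comes from a section, so functions on the jet space may be handled through their
values on pairs of a point and a section. -/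
theorem mem_jetFun_iff {f : Jet n m V → ℝ} :
    f ∈ JetFun n m V ↔ ∃ k, IsOfOrder k fun x (σ : Sec n m V) => f (jet x σ) := by
  refine exists_congr fun k => forall_congr' fun x₀ => ⟨?_, ?_⟩
  · rintro ⟨G, ⟨g, hg, hG⟩, hf⟩
    refine ⟨g, hg, fun x hx σ => ?_⟩
    refine (hf (jet x σ) hx).trans ?_
    rw [hG _ (by rw [coords_jet hx]; exact ⟨x, hx, rfl⟩), coords_jet hx]
    rfl
  · rintro ⟨g, hg, hf⟩
    refine ⟨fun p => g (p.1, fun i α => p.2 i α), ⟨g, hg, fun _ _ => rfl⟩, fun ρ hρ => ?_⟩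
    obtain ⟨⟨x, σ⟩, rfl⟩ := Quotient.exists_rep ρ
    change f (jet x σ) = g (((jet x σ).coords x₀).1, fun i α => ((jet x σ).coords x₀).2 i α)
    rw [coords_jet (x := x) hρ]
    exact hf x hρ σ

/-- Restriction of the fibre coordinates to a smaller order. -/
def truncate {k k' : ℕ} (h : k ≤ k') (u : Fin m → multiIdx n k' → ℝ) :
    Fin m → multiIdx n k → ℝ := fun i α => u i ⟨α, multiIdx_mono h α.2⟩

theorem truncate_jetVec {k k' : ℕ} (h : k ≤ k') (x₀ : M) (s : Sec n m V) (z : 𝔼) :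
    truncate h (jetVec k' x₀ s z) = jetVec k x₀ s z := rfl

theorem IsOfOrder.mono {k k' : ℕ} (h : k ≤ k') {f : M → Sec n m V → ℝ} (hf : IsOfOrder k f) :
    IsOfOrder k' f := by
  intro x₀
  obtain ⟨g, hg, hfg⟩ := hf x₀
  refine ⟨fun p => g (p.1, truncate h p.2), hg.comp (ContDiff.contDiffOn ?_) fun p hp =>
    ⟨hp.1, trivial⟩, hfg⟩
  unfold truncate
  fun_prop

/-- The local formula in the coordinates around x itself sees the section only through its
derivatives at x. Hence the section chosen in `descend` is immaterial. -/
theorem isOfOrder_of_eq_of_jet_eq {k : ℕ} {f : M → Sec n m V → ℝ} (hf : IsOfOrder k f) {x : M}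
    {σ τ : Sec n m V} (h : jet x σ = jet x τ) : f x σ = f x τ := by
  obtain ⟨g, _, hfg⟩ := hf x
  rw [hfg x (mem_adaptedDom_self V x), hfg x (mem_adaptedDom_self V x),
    jetVec_eq_of_jet_eq k (mem_adaptedDom_self V x) h]

/-- The function on the jet space that is given by `f` on the jets of sections. -/
noncomputable def descend (f : M → Sec n m V → ℝ) : Jet n m V → ℝ :=
  fun ρ => f ρ.base (exists_jet_eq ρ).choose

theorem descend_jet {k : ℕ} {f : M → Sec n m V → ℝ} (hf : IsOfOrder k f) (x : M)
    (σ : Sec n m V) : descend f (jet x σ) = f x σ :=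
  isOfOrder_of_eq_of_jet_eq hf (exists_jet_eq (jet x σ)).choose_spec

theorem descend_mem_jetFun {k : ℕ} {f : M → Sec n m V → ℝ} (hf : IsOfOrder k f) :
    descend f ∈ JetFun n m V :=
  mem_jetFun_iff.2 ⟨k, by simpa only [descend_jet hf] using hf⟩

/-- Evaluation at a jet. -/
def evalAt (ρ : Jet n m V) : JetFun n m V →+* ℝ :=
  (Pi.evalRingHom (fun _ => ℝ) ρ).comp (JetFun n m V).val.toRingHom

theorem evalAt_apply (ρ : Jet n m V) (f : JetFun n m V) : evalAt ρ f = f.1 ρ := rfl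

theorem jetFun_ext {f g : JetFun n m V} (h : ∀ x (σ : Sec n m V), f.1 (jet x σ) = g.1 (jet x σ)) :
    f = g := by
  refine Subtype.ext (funext fun ρ => ?_)
  obtain ⟨σ, hσ⟩ := exists_jet_eq ρ
  rw [← hσ]
  exact h _ σ

/-- The vector field given at the jet of each section by a derivation. -/
noncomputable def fieldOf (δ : JetFun n m V → M → Sec n m V → ℝ)
    (hδ : ∀ f, ∃ k, IsOfOrder k (δ f))
    (hadd : ∀ f g x σ, δ (f + g) x σ = δ f x σ + δ g x σ)
    (hsmul : ∀ (c : ℝ) f x σ, δ (c • f) x σ = c * δ f x σ)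
    (hmul : ∀ f g x σ, δ (f * g) x σ = f.1 (jet x σ) * δ g x σ + g.1 (jet x σ) * δ f x σ) :
    JetField n m V :=
  Derivation.mk'
    { toFun := fun f => ⟨descend (δ f), (hδ f).elim fun _ h => descend_mem_jetFun h⟩
      map_add' := fun f g => jetFun_ext fun x σ => by
        obtain ⟨_, h1⟩ := hδ (f + g)
        obtain ⟨_, h2⟩ := hδ f
        obtain ⟨_, h3⟩ := hδ g
        change descend _ _ = descend _ _ + descend _ _
        rw [descend_jet h1, descend_jet h2, descend_jet h3, hadd]
      map_smul' := fun c f => jetFun_ext fun x σ => by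
        obtain ⟨_, h1⟩ := hδ (c • f)
        obtain ⟨_, h2⟩ := hδ f
        change descend _ _ = c * descend _ _
        rw [descend_jet h1, descend_jet h2, hsmul] }
    (fun f g => jetFun_ext fun x σ => by
      obtain ⟨_, h1⟩ := hδ (f * g)
      obtain ⟨_, h2⟩ := hδ f
      obtain ⟨_, h3⟩ := hδ g
      change descend _ _ = f.1 _ * descend _ _ + g.1 _ * descend _ _
      rw [descend_jet h1, descend_jet h2, descend_jet h3, hmul])

theorem fieldOf_apply (δ : JetFun n m V → M → Sec n m V → ℝ) (hδ hadd hsmul hmul)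
    (f : JetFun n m V) (x : M) (σ : Sec n m V) :
    (fieldOf δ hδ hadd hsmul hmul f).1 (jet x σ) = δ f x σ :=
  (hδ f).elim fun _ h => descend_jet h x σ

theorem isOfOrder_base {h : M → ℝ} (hh : ContMDiff (𝓡 n) 𝓘(ℝ, ℝ) ∞ h) :
    IsOfOrder 0 fun x (_ : Sec n m V) => h x := by
  intro x₀
  refine ⟨fun p => h ((ch x₀).symm p.1),
    (contDiffOn_comp_chart_symm x₀ (adaptedDom_subset_source V x₀) hh.contMDiffOn).comp
      contDiffOn_fst fun p hp => hp.1, fun x hx σ => ?_⟩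
  simp only [(ch x₀).left_inv hx.1]

/-- Composition with smooth functions. -/
theorem exists_comp_mem_jetFun {ι : Type} [Fintype ι] (g : ι → JetFun n m V) {H : (ι → ℝ) → ℝ}
    (hH : ContDiff ℝ ∞ H) : (fun ρ => H fun i => (g i).1 ρ) ∈ JetFun n m V := by
  choose k hk using fun i => mem_jetFun_iff.1 (g i).2
  have hk' := fun i => (hk i).mono (Finset.le_sup (f := k) (Finset.mem_univ i))
  refine mem_jetFun_iff.2 ⟨Finset.univ.sup k, fun x₀ => ?_⟩
  choose G hG hgG using fun i => hk' i x₀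
  exact ⟨fun p => H fun i => G i p, hH.comp_contDiffOn (contDiffOn_pi.2 hG), fun x hx σ => by
    simp only [hgG _ x hx]⟩

/-- In Hadamard's expansion around the values of the g i at `ρ`, a derivation kills the constant,
and Leibniz at `ρ` leaves only the coefficients hᵢ there. They do not depend on `X`. -/
theorem exists_chain_rule {ι : Type} [Fintype ι] (g : ι → JetFun n m V) {H : (ι → ℝ) → ℝ}
    (hH : ContDiff ℝ ∞ H) (ρ : Jet n m V) : ∃ c : ι → ℝ, ∀ X : JetField n m V,
      (X ⟨_, exists_comp_mem_jetFun g hH⟩).1 ρ = ∑ i, c i * (X (g i)).1 ρ := by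
  obtain ⟨h, hh, hH'⟩ := exists_hadamard hH fun i => (g i).1 ρ
  refine ⟨fun i => h i fun i => (g i).1 ρ, fun X => ?_⟩
  have : (⟨_, exists_comp_mem_jetFun g hH⟩ : JetFun n m V) =
      algebraMap ℝ (JetFun n m V) (H fun i => (g i).1 ρ) +
      ∑ i, (g i - algebraMap ℝ (JetFun n m V) ((g i).1 ρ)) *
        ⟨_, exists_comp_mem_jetFun g (hh i)⟩ := by
    refine Subtype.ext (funext fun ρ' => ?_)
    rw [← evalAt_apply ρ', ← evalAt_apply ρ', map_add, map_sum]
    simp only [map_mul, map_sub]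
    exact hH' _
  rw [this, map_add, X.map_algebraMap, zero_add, map_sum, ← evalAt_apply, map_sum]
  refine Finset.sum_congr rfl fun i _ => ?_
  rw [Derivation.leibniz, smul_eq_mul, smul_eq_mul, map_add, map_mul, map_mul, map_sub, map_sub,
    X.map_algebraMap, sub_zero]
  have : evalAt ρ (algebraMap ℝ (JetFun n m V) ((g i).1 ρ)) = (g i).1 ρ := rfl
  rw [this, evalAt_apply, sub_self, zero_mul, zero_add]
  rfl

end JetFunctions

end JetGeom

namespace JetGeom

open DiffCalc

/-! ### Jets of sections in adapted coordinates and vertical fields -/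

section Fields

variable {n m : ℕ} {M : Type*} [TopologicalSpace M] [ChartedSpace (EuclideanSpace ℝ (Fin n)) M]
  [IsManifold (𝓡 n) ∞ M] {V : M → Type*} [TopologicalSpace (Bundle.TotalSpace (Fin m → ℝ) V)]
  [∀ x, TopologicalSpace (V x)] [∀ x, AddCommGroup (V x)] [∀ x, Module ℝ (V x)]
  [FiberBundle (Fin m → ℝ) V] [VectorBundle ℝ (Fin m → ℝ) V]
  [ContMDiffVectorBundle ∞ (Fin m → ℝ) V (𝓡 n)]

local notation "𝔼" => EuclideanSpace ℝ (Fin n)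
local notation "ch" => chartAt (EuclideanSpace ℝ (Fin n))

theorem contDiffOn_localComp (x₀ : M) (σ : Sec n m V) (i : Fin m) :
    ContDiffOn ℝ ∞ (localComp x₀ σ i) (coordDom n m V x₀) := by
  have h := ((trivializationAt (Fin m → ℝ) V x₀).contMDiffOn_section_baseSet_iff
    (IB := 𝓡 n) (n := ∞) (s := σ)).1 σ.contMDiff.contMDiffOn
  exact contDiffOn_pi.1 (contDiffOn_comp_chart_symm x₀ (adaptedDom_subset_source V x₀)
    (h.mono Set.inter_subset_right)) i

theorem localComp_chart {x₀ x : M} (hx : x ∈ adaptedDom n m V x₀) (σ : Sec n m V) (i : Fin m) :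
    localComp x₀ σ i (ch x₀ x) = (trivializationAt (Fin m → ℝ) V x₀ ⟨x, σ x⟩).2 i := by
  unfold localComp
  rw [(ch x₀).left_inv hx.1]

theorem localComp_add_smul (x₀ : M) (σ τ : Sec n m V) (ε : ℝ) (i : Fin m) :
    Set.EqOn (localComp x₀ (σ + ε • τ) i) (fun z => localComp x₀ σ i z + ε * localComp x₀ τ i z)
      (coordDom n m V x₀) := by
  intro z hz
  have hl := (trivializationAt (Fin m → ℝ) V x₀).linear ℝ (symm_mem_adaptedDom hz).2
  have h1 := congrFun (hl.map_add (σ ((ch x₀).symm z)) (ε • τ ((ch x₀).symm z))) i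
  have h2 := congrFun (hl.map_smul ε (τ ((ch x₀).symm z))) i
  rw [Pi.add_apply, h2, Pi.smul_apply] at h1
  exact h1

/-- Trivializations are fibrewise linear and derivatives are linear, so ε ↦ σ + ετ is a straight
line in jet coordinates. -/
theorem jetVec_add_smul (k : ℕ) {x₀ : M} (σ τ : Sec n m V) (ε : ℝ) {z : 𝔼}
    (hz : z ∈ coordDom n m V x₀) :
    jetVec k x₀ (σ + ε • τ) z = jetVec k x₀ σ z + ε • jetVec k x₀ τ z := by
  funext i α
  have hO := isOpen_coordDom (n := n) (m := m) V x₀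
  exact (iterOps_basePartial_congr hO (localComp_add_smul x₀ σ τ ε i) α hz).trans
    (iterOps_basePartial_add_smul hO (contDiffOn_localComp x₀ σ i) (contDiffOn_localComp x₀ τ i)
      ε α hz)

theorem contDiffOn_jetVec (k : ℕ) (x₀ : M) (σ : Sec n m V) :
    ContDiffOn ℝ ∞ (jetVec k x₀ σ) (coordDom n m V x₀) :=
  contDiffOn_pi.2 fun i => contDiffOn_pi.2 fun α =>
    contDiffOn_iterOps_basePartial (isOpen_coordDom V x₀) (contDiffOn_localComp x₀ σ i) α

theorem add_single_mem_multiIdx {k : ℕ} {α : Fin n → ℕ} (hα : α ∈ multiIdx n k) (j : Fin n) :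
    α + Pi.single j 1 ∈ multiIdx n (k + 1) := by
  simp only [multiIdx, Finset.mem_filter, Fintype.mem_piFinset, Finset.mem_range] at hα ⊢
  refine ⟨fun i => ?_, ?_⟩
  · have := hα.1 i
    by_cases h : i = j
    · subst h; simp; omega
    · simp [h]; omega
  · simp only [Pi.add_apply, Finset.sum_add_distrib, Finset.sum_pi_single', Finset.mem_univ,
      if_true]
    omega

/-- The fibre components of the total derivative in the direction `w`. -/
def shift {k : ℕ} (w : 𝔼) (u : Fin m → multiIdx n (k + 1) → ℝ) : Fin m → multiIdx n k → ℝ :=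
  fun i α => ∑ j, w j * u i ⟨α.1 + Pi.single j 1, add_single_mem_multiIdx α.2 j⟩

/-- Along a section the derivative of uⁱ_α in direction xʲ is uⁱ_{α + xʲ}. This is why total
derivatives raise the order by one. -/
theorem fderiv_jetVec (k : ℕ) {x₀ : M} (σ : Sec n m V) {z : 𝔼} (hz : z ∈ coordDom n m V x₀)
    (w : 𝔼) : fderiv ℝ (jetVec k x₀ σ) z w = shift w (jetVec (k + 1) x₀ σ z) := by
  have hO := isOpen_coordDom (n := n) (m := m) V x₀
  have hw : w = ∑ j, w j • EuclideanSpace.single j (1 : ℝ) := by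
    ext i
    simp [Finset.sum_apply, Pi.single_apply]
  have hd : ∀ i (α : multiIdx n k), ContDiffOn ℝ ∞
      (iterOps basePartial α.1 (localComp x₀ σ i)) (coordDom n m V x₀) := fun i α =>
    contDiffOn_iterOps_basePartial hO (contDiffOn_localComp x₀ σ i) α
  have hd' := fun i α => ((hd i α).contDiffAt (hO.mem_nhds hz)).differentiableAt (by simp)
  funext i α
  have h1 : HasFDerivAt (jetVec k x₀ σ) (ContinuousLinearMap.pi fun i =>
      ContinuousLinearMap.pi fun α : multiIdx n k =>
        fderiv ℝ (iterOps basePartial α.1 (localComp x₀ σ i)) z) z :=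
    hasFDerivAt_pi.2 fun i => hasFDerivAt_pi.2 fun α => (hd' i α).hasFDerivAt
  rw [h1.fderiv]
  change fderiv ℝ (iterOps basePartial α.1 (localComp x₀ σ i)) z w = _
  conv_lhs => rw [hw, map_sum]
  refine Finset.sum_congr rfl fun j _ => ?_
  rw [map_smul, smul_eq_mul, ← basePartial_eq_fderiv hO (hd i α) hz]
  congr 1
  exact (iterOps_basePartial_add_single hO (contDiffOn_localComp x₀ σ i) α j hz).symm

/-- A function on the jet space in adapted coordinates, along sections. -/
theorem exists_rep (f : JetFun n m V) : ∃ k, ∀ x₀,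
    ∃ g : 𝔼 × (Fin m → multiIdx n k → ℝ) → ℝ,
      ContDiffOn ℝ ∞ g (coordDom n m V x₀ ×ˢ Set.univ) ∧
      ∀ z ∈ coordDom n m V x₀, ∀ σ, f.1 (jet ((ch x₀).symm z) σ) = g (z, jetVec k x₀ σ z) := by
  obtain ⟨k, hk⟩ := mem_jetFun_iff.1 f.2
  refine ⟨k, fun x₀ => ?_⟩
  obtain ⟨g, hg, h⟩ := hk x₀
  refine ⟨g, hg, fun z hz σ => ?_⟩
  have := h _ (symm_mem_adaptedDom hz) σ
  rwa [chart_symm_of_mem hz] at this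

theorem isOpen_coordDom_prod (x₀ : M) (k : ℕ) :
    IsOpen (coordDom n m V x₀ ×ˢ (Set.univ : Set (Fin m → multiIdx n k → ℝ))) :=
  (isOpen_coordDom V x₀).prod isOpen_univ

/-- Joint smoothness in ε and the base point is what allows derivatives in the two directions to be
exchanged. -/
theorem contDiffOn_family (f : JetFun n m V) (x₀ : M) (σ τ : Sec n m V) :
    ContDiffOn ℝ ∞ (fun q : ℝ × 𝔼 => f.1 (jet ((ch x₀).symm q.2) (σ + q.1 • τ)))
      (Set.univ ×ˢ coordDom n m V x₀) := by
  obtain ⟨k, hk⟩ := exists_rep f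
  obtain ⟨g, hg, h⟩ := hk x₀
  have h1 : ∀ σ : Sec n m V, ContDiffOn ℝ ∞ (fun q : ℝ × 𝔼 => jetVec k x₀ σ q.2)
      (Set.univ ×ˢ coordDom n m V x₀) := fun σ =>
    (contDiffOn_jetVec k x₀ σ).comp contDiffOn_snd fun q hq => hq.2
  refine (hg.comp (contDiffOn_snd.prodMk ((h1 σ).add (contDiffOn_fst.smul (h1 τ))))
    fun q hq => ⟨hq.2, trivial⟩).congr fun q hq => ?_
  rw [h _ hq.2, jetVec_add_smul k σ τ q.1 hq.2]
  rfl

theorem contDiffOn_comp_jet (f : JetFun n m V) (x₀ : M) (σ : Sec n m V) :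
    ContDiffOn ℝ ∞ (fun z => f.1 (jet ((ch x₀).symm z) σ)) (coordDom n m V x₀) := by
  obtain ⟨k, hk⟩ := exists_rep f
  obtain ⟨g, hg, h⟩ := hk x₀
  exact (hg.comp (contDiffOn_id.prodMk (contDiffOn_jetVec k x₀ σ)) fun q hq => ⟨hq, trivial⟩).congr
    fun q hq => h q hq σ

theorem contMDiff_comp_jet (f : JetFun n m V) (σ : Sec n m V) :
    ContMDiff (𝓡 n) 𝓘(ℝ, ℝ) ∞ fun y => f.1 (jet y σ) := by
  intro x
  have h := (contMDiffOn_iff_contDiffOn.2 (contDiffOn_comp_jet f x σ)).comp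
    ((contMDiffOn_chart (I := 𝓡 n) (x := x) (n := ∞)).mono (adaptedDom_subset_source V x))
    fun y hy => chart_mem_coordDom hy
  refine ((h.congr fun y hy => ?_).contMDiffAt
    ((isOpen_adaptedDom V x).mem_nhds (mem_adaptedDom_self V x)))
  simp only [Function.comp, (ch x).left_inv hy.1]

/-! ### Vertical translations -/

theorem differentiable_comp_jet_add_smul (f : JetFun n m V) (x : M) (σ τ : Sec n m V) :
    Differentiable ℝ fun ε : ℝ => f.1 (jet x (σ + ε • τ)) := by
  have h := (contDiffOn_family f x σ τ).comp (s := Set.univ) (f := fun ε : ℝ => (ε, ch x x))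
    (by fun_prop) fun ε _ => ⟨trivial, chart_mem_coordDom (mem_adaptedDom_self V x)⟩
  simp only [Function.comp_def, (ch x).left_inv (mem_chart_source _ x)] at h
  exact (contDiffOn_univ.1 h).differentiable (by simp)

/-- In coordinates this is the derivative of the representative in the vertical direction given by
the jet of `τ`. As `τ` is fixed, its jet is a smooth function of the base point and the order does
not grow. -/
theorem isOfOrder_deriv_add_smul (τ : Sec n m V) (f : JetFun n m V) :
    ∃ k, IsOfOrder k fun x (σ : Sec n m V) => deriv (fun ε : ℝ => f.1 (jet x (σ + ε • τ))) 0 := by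
  obtain ⟨k, hk⟩ := exists_rep f
  refine ⟨k, fun x₀ => ?_⟩
  obtain ⟨g, hg, h⟩ := hk x₀
  refine ⟨fun p => fderiv ℝ g p (0, jetVec k x₀ τ p.1), ?_, fun x hx σ => ?_⟩
  · exact (hg.fderiv_of_isOpen (isOpen_coordDom_prod x₀ k) (m := ∞) (by simp)).clm_apply
      (contDiffOn_const.prodMk ((contDiffOn_jetVec k x₀ τ).comp contDiffOn_fst fun p hp => hp.1))
  · have hz := chart_mem_coordDom hx
    have h' : ∀ ε : ℝ, f.1 (jet x (σ + ε • τ)) =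
        g (ch x₀ x, jetVec k x₀ σ (ch x₀ x) + ε • jetVec k x₀ τ (ch x₀ x)) := by
      intro ε
      rw [← jetVec_add_smul k σ τ ε hz, ← h _ hz, (ch x₀).left_inv hx.1]
    simp only [h']
    have hd : HasDerivAt (fun ε : ℝ =>
        (ch x₀ x, jetVec k x₀ σ (ch x₀ x) + ε • jetVec k x₀ τ (ch x₀ x)))
        ((0 : 𝔼), jetVec k x₀ τ (ch x₀ x)) 0 := by
      refine (hasDerivAt_const (0 : ℝ) (ch x₀ x)).prodMk ?_
      simpa using ((hasDerivAt_id (0 : ℝ)).smul_const (jetVec k x₀ τ (ch x₀ x))).const_add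
        (jetVec k x₀ σ (ch x₀ x))
    have hg' : HasFDerivAt g (fderiv ℝ g (ch x₀ x, jetVec k x₀ σ (ch x₀ x)))
        (ch x₀ x, jetVec k x₀ σ (ch x₀ x) + (0 : ℝ) • jetVec k x₀ τ (ch x₀ x)) := by
      rw [zero_smul, add_zero]
      exact ((hg.contDiffAt ((isOpen_coordDom_prod x₀ k).mem_nhds ⟨hz, trivial⟩)).differentiableAt
        (by simp)).hasFDerivAt
    exact (hg'.comp_hasDerivAt (0 : ℝ) hd).deriv

/-- The evolutionary field of the generating section that is the pullback of `τ`. -/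
noncomputable def translationField (τ : Sec n m V) : JetField n m V :=
  fieldOf (fun f x σ => deriv (fun ε : ℝ => f.1 (jet x (σ + ε • τ))) 0)
    (isOfOrder_deriv_add_smul τ)
    (fun f g x σ => by
      exact deriv_fun_add (differentiable_comp_jet_add_smul f x σ τ 0)
        (differentiable_comp_jet_add_smul g x σ τ 0))
    (fun c f x σ => by
      exact deriv_const_mul c (differentiable_comp_jet_add_smul f x σ τ 0))
    (fun f g x σ => by
      have h := deriv_fun_mul (differentiable_comp_jet_add_smul f x σ τ 0)
        (differentiable_comp_jet_add_smul g x σ τ 0)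
      simp only [zero_smul, add_zero] at h
      refine h.trans ?_
      ring)

theorem translationField_apply (τ : Sec n m V) (f : JetFun n m V) (x : M) (σ : Sec n m V) :
    (translationField τ f).1 (jet x σ) = deriv (fun ε : ℝ => f.1 (jet x (σ + ε • τ))) 0 :=
  fieldOf_apply _ _ _ _ _ f x σ

theorem isVerticalAt_translationField (τ : Sec n m V) (ρ : Jet n m V) :
    IsVerticalAt (translationField τ) ρ := by
  intro f hf
  obtain ⟨σ, hσ⟩ := exists_jet_eq ρ
  rw [← hσ, translationField_apply, show (fun ε : ℝ => f.1 (jet ρ.base (σ + ε • τ))) =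
    fun _ => f.1 (jet ρ.base σ) from funext fun ε => hf _ _ rfl, deriv_const]

/-- The element of `ϰ(π)` that is the pullback of a section. -/
noncomputable def pullbackSection (τ : Sec n m V) : JetSection n m V m V where
  val ρ := τ ρ.base
  smooth := by
    refine ⟨0, fun x₀ i => ⟨fun p => localComp x₀ τ i p.1, ⟨fun p => localComp x₀ τ i p.1, ?_,
      fun _ _ => rfl⟩, fun ρ hρ => ?_⟩⟩
    · exact (contDiffOn_localComp x₀ τ i).comp contDiffOn_fst fun p hp =>
        Set.image_mono (Set.inter_subset_left) hp.1
    · obtain ⟨σ, hσ⟩ := exists_jet_eq ρ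
      have h1 : (ρ.coords x₀).1 = ch x₀ ρ.base := by
        conv_lhs => rw [← hσ]
        rw [coords_jet hρ.1]
      change _ = localComp x₀ τ i (ρ.coords x₀).1
      rw [h1]
      rw [localComp_chart hρ.1]

theorem isEvolutionary_translationField (τ : Sec n m V) :
    IsEvolutionary (pullbackSection τ) (translationField τ) := fun σ =>
  ⟨τ, fun _ => rfl, fun x f => translationField_apply τ f x σ⟩

end Fields

end JetGeom

namespace JetGeom

open DiffCalc

/-! ### Cut-off lifts to the Cartan distribution -/

section CartanFields

variable {n m : ℕ} {M : Type*} [TopologicalSpace M] [ChartedSpace (EuclideanSpace ℝ (Fin n)) M]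
  [IsManifold (𝓡 n) ∞ M] {V : M → Type*} [TopologicalSpace (Bundle.TotalSpace (Fin m → ℝ) V)]
  [∀ x, TopologicalSpace (V x)] [∀ x, AddCommGroup (V x)] [∀ x, Module ℝ (V x)]
  [FiberBundle (Fin m → ℝ) V] [VectorBundle ℝ (Fin m → ℝ) V]
  [ContMDiffVectorBundle ∞ (Fin m → ℝ) V (𝓡 n)]

local notation "𝔼" => EuclideanSpace ℝ (Fin n)
local notation "ch" => chartAt (EuclideanSpace ℝ (Fin n))

/-- The derivative along sections in the direction of the vector field `χ v` in the chart
around `x₁`. -/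
noncomputable def alongSections (x₁ : M) (χ : M → ℝ) (v : 𝔼) (f : JetFun n m V) (y : M)
    (σ : Sec n m V) : ℝ :=
  χ y * fderiv ℝ (fun z => f.1 (jet ((ch x₁).symm z) σ)) (ch x₁ y) v

/-- The components of the vector field `χ v` in the chart around `x₀`. -/
noncomputable def fieldComp (x₁ : M) (χ : M → ℝ) (v : 𝔼) (x₀ : M) (z : 𝔼) : 𝔼 :=
  χ ((ch x₀).symm z) • fderiv ℝ (fun z' => ch x₀ ((ch x₁).symm z')) (ch x₁ ((ch x₀).symm z)) v

theorem contDiffOn_transition (x₀ x₁ : M) :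
    ContDiffOn ℝ ∞ (fun z => ch x₀ ((ch x₁).symm z))
      (ch x₁ '' ((ch x₁).source ∩ (ch x₀).source)) :=
  contDiffOn_comp_chart_symm (F := 𝔼) x₁ Set.inter_subset_left
    ((contMDiffOn_chart (I := 𝓡 n) (x := x₀) (n := ∞)).mono Set.inter_subset_right)

theorem isOpen_overlap (x₀ x₁ : M) :
    IsOpen (ch x₁ '' ((ch x₁).source ∩ (ch x₀).source)) :=
  (ch x₁).isOpen_image_of_subset_source ((ch x₁).open_source.inter (ch x₀).open_source)
    Set.inter_subset_left

variable {x₁ : M} {χ : M → ℝ}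

/-- On the support of χ both charts are available and the transition map is smooth; near every other
point the field is zero. -/
theorem contDiffOn_fieldComp (hχ : ContMDiff (𝓡 n) 𝓘(ℝ, ℝ) ∞ χ)
    (hs : tsupport χ ⊆ (ch x₁).source) (v : 𝔼) (x₀ : M) :
    ContDiffOn ℝ ∞ (fieldComp x₁ χ v x₀) (ch x₀).target := by
  intro z hz
  refine ContDiffAt.contDiffWithinAt ?_
  have hz0 := (ch x₀).map_target hz
  by_cases h : (ch x₀).symm z ∈ tsupport χ
  · have hmem : z ∈ ch x₀ '' ((ch x₀).source ∩ (ch x₁).source) :=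
      ⟨_, ⟨hz0, hs h⟩, (ch x₀).right_inv hz⟩
    have h1 : ContDiffAt ℝ ∞ (fun z => χ ((ch x₀).symm z)) z :=
      (contDiffOn_comp_chart_symm x₀ Set.inter_subset_left hχ.contMDiffOn).contDiffAt
        ((isOpen_overlap x₁ x₀).mem_nhds hmem)
    have h2 : ContDiffAt ℝ ∞ (fun z => ch x₁ ((ch x₀).symm z)) z :=
      (contDiffOn_transition x₁ x₀).contDiffAt ((isOpen_overlap x₁ x₀).mem_nhds hmem)
    have h3 : ContDiffAt ℝ ∞ (fderiv ℝ fun z' => ch x₀ ((ch x₁).symm z'))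
        (ch x₁ ((ch x₀).symm z)) :=
      ((contDiffOn_transition x₀ x₁).fderiv_of_isOpen (isOpen_overlap x₀ x₁)
        (m := ∞) (by simp)).contDiffAt ((isOpen_overlap x₀ x₁).mem_nhds ⟨_, ⟨hs h, hz0⟩, rfl⟩)
    exact h1.smul ((h3.comp z h2).clm_apply contDiffAt_const)
  · have h0 : fieldComp x₁ χ v x₀ =ᶠ[nhds z] fun _ => 0 := by
      have : ∀ᶠ y in nhds ((ch x₀).symm z), χ y = 0 := by
        filter_upwards [(isClosed_tsupport χ).isOpen_compl.mem_nhds h] with y hy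
        exact image_eq_zero_of_notMem_tsupport hy
      filter_upwards [((ch x₀).symm.continuousAt hz).eventually this] with z' hz'
      rw [fieldComp, hz', zero_smul]
    exact contDiffAt_const.congr_of_eventuallyEq h0

theorem differentiableAt_comp_jet (f : JetFun n m V) {y : M} (hy : y ∈ adaptedDom n m V x₁)
    (σ : Sec n m V) :
    DifferentiableAt ℝ (fun z => f.1 (jet ((ch x₁).symm z) σ)) (ch x₁ y) :=
  ((contDiffOn_comp_jet f x₁ σ).contDiffAt ((isOpen_coordDom V x₁).mem_nhds
    (chart_mem_coordDom hy))).differentiableAt (by simp)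

/-- In the coordinates around any x₀ this is a total derivative along the components of χ v, hence
of order one more than `f`. The cut-off is what makes it global. -/
theorem isOfOrder_alongSections (hχ : ContMDiff (𝓡 n) 𝓘(ℝ, ℝ) ∞ χ)
    (hs : tsupport χ ⊆ adaptedDom n m V x₁) (v : 𝔼) (f : JetFun n m V) :
    ∃ k, IsOfOrder k (alongSections x₁ χ v f) := by
  obtain ⟨k, hk⟩ := exists_rep f
  refine ⟨k + 1, fun x₀ => ?_⟩
  obtain ⟨g, hg, h⟩ := hk x₀
  have hO := isOpen_coordDom (n := n) (m := m) V x₀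
  have hw := (contDiffOn_fieldComp hχ (hs.trans (adaptedDom_subset_source V x₁)) v x₀).mono
    fun z hz => mem_target_of_mem_coordDom (V := V) (m := m) hz
  refine ⟨fun p => fderiv ℝ g (p.1, truncate k.le_succ p.2)
    (fieldComp x₁ χ v x₀ p.1, shift (fieldComp x₁ χ v x₀ p.1) p.2), ?_, fun y hy σ => ?_⟩
  · have hw' : ContDiffOn ℝ ∞ (fun p : 𝔼 × (Fin m → multiIdx n (k + 1) → ℝ) =>
        fieldComp x₁ χ v x₀ p.1) (coordDom n m V x₀ ×ˢ Set.univ) :=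
      hw.comp contDiffOn_fst fun p hp => hp.1
    refine ((hg.fderiv_of_isOpen (isOpen_coordDom_prod x₀ k) (m := ∞) (by simp)).comp
      (ContDiff.contDiffOn ?_) fun p hp => ⟨hp.1, trivial⟩).clm_apply (hw'.prodMk ?_)
    · unfold truncate
      fun_prop
    · refine contDiffOn_pi.2 fun i => contDiffOn_pi.2 fun α => ContDiffOn.sum fun j _ =>
        ContDiffOn.mul ?_ (ContDiff.contDiffOn (by fun_prop))
      exact (contDiff_piLp_apply 2).comp_contDiffOn hw'
  · have hz := chart_mem_coordDom hy
    simp only [alongSections, truncate_jetVec]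
    by_cases hy1 : y ∈ adaptedDom n m V x₁
    · have hd : DifferentiableAt ℝ (fun z => g (z, jetVec k x₀ σ z)) (ch x₀ y) :=
        ((hg.comp (contDiffOn_id.prodMk (contDiffOn_jetVec k x₀ σ))
          fun q hq => ⟨hq, trivial⟩).contDiffAt (hO.mem_nhds hz)).differentiableAt (by simp)
      have hT : DifferentiableAt ℝ (fun z => ch x₀ ((ch x₁).symm z)) (ch x₁ y) :=
        ((contDiffOn_transition x₀ x₁).contDiffAt
          ((isOpen_overlap x₀ x₁).mem_nhds ⟨y, ⟨hy1.1, hy.1⟩, rfl⟩)).differentiableAt (by simp)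
      have hTy : ch x₀ ((ch x₁).symm (ch x₁ y)) = ch x₀ y := by rw [(ch x₁).left_inv hy1.1]
      -- Near y the function in the chart around x₁ is the representative around x₀ composed with
      -- the transition map; the chain rule does the rest.
      have heq : (fun z => f.1 (jet ((ch x₁).symm z) σ)) =ᶠ[nhds (ch x₁ y)]
          (fun z => g (z, jetVec k x₀ σ z)) ∘ fun z => ch x₀ ((ch x₁).symm z) := by
        have hopen : IsOpen (ch x₁ '' (adaptedDom n m V x₁ ∩ adaptedDom n m V x₀)) :=
          (ch x₁).isOpen_image_of_subset_source
            ((isOpen_adaptedDom V x₁).inter (isOpen_adaptedDom V x₀))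
            fun q hq => hq.1.1
        filter_upwards [hopen.mem_nhds ⟨y, ⟨hy1, hy⟩, rfl⟩] with z hz'
        obtain ⟨q, hq, rfl⟩ := hz'
        simp only [Function.comp]
        rw [(ch x₁).left_inv hq.1.1, ← h _ (chart_mem_coordDom hq.2), (ch x₀).left_inv hq.2.1]
      rw [heq.fderiv_eq, fderiv_comp _ (by rwa [hTy]) hT, hTy]
      have hfc : fieldComp x₁ χ v x₀ (ch x₀ y) =
          χ y • fderiv ℝ (fun z' => ch x₀ ((ch x₁).symm z')) (ch x₁ y) v := by
        rw [fieldComp, (ch x₀).left_inv hy.1]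
      have hmem : (ch x₀ y, jetVec k x₀ σ (ch x₀ y)) ∈
          coordDom n m V x₀ ×ˢ (Set.univ : Set (Fin m → multiIdx n k → ℝ)) := ⟨hz, trivial⟩
      have hgd := (hg.contDiffAt ((isOpen_coordDom_prod x₀ k).mem_nhds hmem)).differentiableAt
        (by simp)
      have hjd := ((contDiffOn_jetVec k x₀ σ).contDiffAt (hO.mem_nhds hz)).differentiableAt
        (by simp)
      have hG : ∀ w, fderiv ℝ (fun z => g (z, jetVec k x₀ σ z)) (ch x₀ y) w =
          fderiv ℝ g (ch x₀ y, jetVec k x₀ σ (ch x₀ y))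
            (w, shift w (jetVec (k + 1) x₀ σ (ch x₀ y))) := by
        intro w
        have := hgd.hasFDerivAt.comp (ch x₀ y) ((hasFDerivAt_id (ch x₀ y)).prodMk hjd.hasFDerivAt)
        rw [show (fun z => g (z, jetVec k x₀ σ z)) = g ∘ fun z => (id z, jetVec k x₀ σ z) from rfl,
          this.fderiv, ← fderiv_jetVec k σ hz]
        rfl
      rw [← hG, hfc, map_smul]
      rfl
    · have h0 : χ y = 0 := image_eq_zero_of_notMem_tsupport fun h' => hy1 (hs h')
      have hfc : fieldComp x₁ χ v x₀ (ch x₀ y) = 0 := by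
        rw [fieldComp, (ch x₀).left_inv hy.1, h0, zero_smul]
      have hsh : shift (0 : 𝔼) (jetVec (k + 1) x₀ σ (ch x₀ y)) = 0 := by
        funext i α
        simp [shift]
      rw [h0, zero_mul, hfc, hsh, ← Prod.zero_eq_mk, map_zero]

/-- The vector field on the jet space that lifts the vector field `χ v` of `M` to the Cartan
distribution. -/
noncomputable def cartanField (hχ : ContMDiff (𝓡 n) 𝓘(ℝ, ℝ) ∞ χ)
    (hs : tsupport χ ⊆ adaptedDom n m V x₁) (v : 𝔼) : JetField n m V :=
  fieldOf (alongSections x₁ χ v) (isOfOrder_alongSections hχ hs v)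
    (fun f g y σ => by
      unfold alongSections
      by_cases hy : y ∈ adaptedDom n m V x₁
      · rw [← mul_add]
        congr 1
        exact congrArg (fun L : 𝔼 →L[ℝ] ℝ => L v) (fderiv_fun_add
          (differentiableAt_comp_jet f hy σ) (differentiableAt_comp_jet g hy σ))
      · simp [image_eq_zero_of_notMem_tsupport fun h' => hy (hs h')])
    (fun c f y σ => by
      unfold alongSections
      by_cases hy : y ∈ adaptedDom n m V x₁
      · rw [mul_left_comm]
        congr 1
        exact congrArg (fun L : 𝔼 →L[ℝ] ℝ => L v)
          (fderiv_const_mul (differentiableAt_comp_jet f hy σ) c)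
      · simp [image_eq_zero_of_notMem_tsupport fun h' => hy (hs h')])
    (fun f g y σ => by
      unfold alongSections
      by_cases hy : y ∈ adaptedDom n m V x₁
      · have h := congrArg (fun L : 𝔼 →L[ℝ] ℝ => L v) (fderiv_fun_mul
          (differentiableAt_comp_jet f hy σ) (differentiableAt_comp_jet g hy σ))
        simp only [(ch x₁).left_inv hy.1] at h
        refine (congrArg (χ y * ·) h).trans ?_
        simp only [add_apply, smul_apply, smul_eq_mul]
        ring
      · simp [image_eq_zero_of_notMem_tsupport fun h' => hy (hs h')])

variable (hχ : ContMDiff (𝓡 n) 𝓘(ℝ, ℝ) ∞ χ) (hs : tsupport χ ⊆ adaptedDom n m V x₁)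

theorem cartanField_apply (v : 𝔼) (f : JetFun n m V) (y : M) (σ : Sec n m V) :
    (cartanField hχ hs v f).1 (jet y σ) =
      χ y * fderiv ℝ (fun z => f.1 (jet ((ch x₁).symm z) σ)) (ch x₁ y) v :=
  fieldOf_apply _ _ _ _ _ f y σ

/-- The tangent space at x is modelled by the preferred chart at x, so no transition map appears.
This is why lifts at x₁ are taken in the chart around x₁. -/
theorem mfderiv_comp_jet_eq (f : JetFun n m V) (x : M) (σ : Sec n m V) (v : 𝔼) :
    mfderiv (𝓡 n) 𝓘(ℝ, ℝ) (fun y => f.1 (jet y σ)) x v =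
      fderiv ℝ (fun z => f.1 (jet ((ch x).symm z) σ)) (ch x x) v := by
  have h := (contMDiff_comp_jet f σ).mdifferentiableAt (x := x) (by simp)
  rw [h.mfderiv, ModelWithCorners.range_eq_univ, fderivWithin_univ]
  rfl

theorem isLiftAt_cartanField (v : 𝔼) (hχ1 : χ x₁ = 1) (ρ : Jet n m V) (hρ : ρ.base = x₁) :
    IsLiftAt (cartanField hχ hs v) ρ v := by
  rintro x σ rfl f
  obtain rfl : x = x₁ := hρ
  rw [cartanField_apply, hχ1, one_mul]
  exact (mfderiv_comp_jet_eq f x σ v).symm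

/-- Over the adapted domain the vector lifted is χ times the image of `v` under the inverse chart;
elsewhere χ vanishes and the zero vector is lifted. -/
theorem isCartanAt_cartanField (v : 𝔼) (ρ : Jet n m V) : IsCartanAt (cartanField hχ hs v) ρ := by
  by_cases hy : ρ.base ∈ adaptedDom n m V x₁
  · refine ⟨χ ρ.base • (mfderiv (𝓡 n) (𝓡 n) (ch x₁).symm (ch x₁ ρ.base) v : 𝔼), ?_⟩
    rintro x σ rfl f
    have hx : x ∈ (ch x₁).source := hy.1
    rw [cartanField_apply, jet_base]
    have h1 : MDifferentiableAt (𝓡 n) 𝓘(ℝ, ℝ) (fun y => f.1 (jet y σ))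
        ((ch x₁).symm (ch x₁ x)) := (contMDiff_comp_jet f σ).mdifferentiableAt (by simp)
    have h2 : MDifferentiableAt (𝓡 n) (𝓡 n) (ch x₁).symm (ch x₁ x) :=
      ((contMDiffOn_chart_symm (I := 𝓡 n) (x := x₁) (n := ∞)).contMDiffAt
        ((ch x₁).open_target.mem_nhds ((ch x₁).map_source hx))).mdifferentiableAt (by simp)
    have h3 := mfderiv_comp (ch x₁ x) h1 h2
    have h4 : fderiv ℝ (fun z => f.1 (jet ((ch x₁).symm z) σ)) (ch x₁ x) v =
        mfderiv (𝓡 n) 𝓘(ℝ, ℝ) (fun y => f.1 (jet y σ)) ((ch x₁).symm (ch x₁ x))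
          (mfderiv (𝓡 n) (𝓡 n) (ch x₁).symm (ch x₁ x) v) := by
      rw [← mfderiv_eq_fderiv]
      exact congrArg (fun L : 𝔼 →L[ℝ] ℝ => L v) h3
    -- The points (ch x₁).symm (ch x₁ x) and x are only propositionally equal, so the dependent
    -- tangent spaces are both read as 𝔼 before the base point is changed.
    have h5 : ∀ (x' : M) (hx' : x' = x) (u : 𝔼),
        (mfderiv (𝓡 n) 𝓘(ℝ, ℝ) (fun y => f.1 (jet y σ)) x' : 𝔼 →L[ℝ] ℝ) u =
        (mfderiv (𝓡 n) 𝓘(ℝ, ℝ) (fun y => f.1 (jet y σ)) x : 𝔼 →L[ℝ] ℝ) u := by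
      rintro _ rfl u
      rfl
    rw [h4]
    refine (congrArg (χ x * ·) (h5 _ ((ch x₁).left_inv hx) _)).trans ?_
    exact (map_smul (mfderiv (𝓡 n) 𝓘(ℝ, ℝ) (fun y => f.1 (jet y σ)) x : 𝔼 →L[ℝ] ℝ)
      (χ x) (mfderiv (𝓡 n) (𝓡 n) (ch x₁).symm (ch x₁ x) v : 𝔼)).symm
  · refine ⟨0, ?_⟩
    rintro x σ rfl f
    have h0 : χ x = 0 := image_eq_zero_of_notMem_tsupport fun h' => hy (hs h')
    rw [cartanField_apply, h0, zero_mul]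
    exact (map_zero _).symm

/-- The two compositions are the mixed second derivatives of (ε, z) ↦ f(j_z(σ + ετ)), one variable
each, multiplied by χ, which does not depend on ε. -/
theorem lie_translationField_cartanField (v : 𝔼) (τ : Sec n m V) :
    ⁅translationField τ, cartanField hχ hs v⁆ = 0 := by
  refine Derivation.ext fun f => jetFun_ext fun y σ => ?_
  rw [Derivation.commutator_apply]
  change (translationField τ (cartanField hχ hs v f)).1 (jet y σ) -
    (cartanField hχ hs v (translationField τ f)).1 (jet y σ) = 0
  rw [translationField_apply, cartanField_apply, sub_eq_zero]
  simp only [cartanField_apply, translationField_apply]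
  by_cases hy : y ∈ adaptedDom n m V x₁
  · have hΦ := contDiffOn_family f x₁ σ τ
    set Φ : ℝ × 𝔼 → ℝ := fun q => f.1 (jet ((ch x₁).symm q.2) (σ + q.1 • τ)) with hΦdef
    have hO : IsOpen ((Set.univ : Set ℝ) ×ˢ coordDom n m V x₁) :=
      isOpen_univ.prod (isOpen_coordDom V x₁)
    have hmem : ∀ ε : ℝ, ((ε, ch x₁ y) : ℝ × 𝔼) ∈ (Set.univ : Set ℝ) ×ˢ coordDom n m V x₁ :=
      fun ε => ⟨trivial, chart_mem_coordDom hy⟩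
    have e1 : ∀ ε : ℝ, fderiv ℝ (fun z => f.1 (jet ((ch x₁).symm z) (σ + ε • τ))) (ch x₁ y) v =
        fderiv ℝ Φ (ε, ch x₁ y) (0, v) := by
      intro ε
      have := ((hΦ.contDiffAt (hO.mem_nhds (hmem ε))).differentiableAt
        (by simp)).hasFDerivAt.comp (ch x₁ y) (hasFDerivAt_prodMk_right ε (ch x₁ y))
      exact congrArg (fun L : 𝔼 →L[ℝ] ℝ => L v) this.fderiv
    have e2 : ∀ q ∈ (Set.univ : Set ℝ) ×ˢ coordDom n m V x₁, ∀ Ψ : ℝ × 𝔼 → ℝ,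
        DifferentiableAt ℝ Ψ q → deriv (fun ε : ℝ => Ψ (ε, q.2)) q.1 = fderiv ℝ Ψ q (1, 0) := by
      intro q _ Ψ hΨ
      exact (hΨ.hasFDerivAt.comp_hasDerivAt q.1
        ((hasDerivAt_id q.1).prodMk (hasDerivAt_const q.1 q.2))).deriv
    have hsm : ∀ a, ContDiffOn ℝ ∞ (fun q => fderiv ℝ Φ q a)
        ((Set.univ : Set ℝ) ×ˢ coordDom n m V x₁) := contDiffOn_fderiv_apply_const hO hΦ
    have hda : ∀ Ψ : ℝ × 𝔼 → ℝ, ContDiffOn ℝ ∞ Ψ ((Set.univ : Set ℝ) ×ˢ coordDom n m V x₁) →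
        ∀ q ∈ (Set.univ : Set ℝ) ×ˢ coordDom n m V x₁, DifferentiableAt ℝ Ψ q := fun Ψ hΨ q hq =>
      (hΨ.contDiffAt (hO.mem_nhds hq)).differentiableAt (by simp)
    have e3 : (fun z => deriv (fun ε : ℝ => f.1 (jet ((ch x₁).symm z) (σ + ε • τ))) 0)
        =ᶠ[nhds (ch x₁ y)] fun z => fderiv ℝ Φ (0, z) (1, 0) := by
      filter_upwards [(isOpen_coordDom V x₁).mem_nhds (chart_mem_coordDom hy)] with z hz
      exact e2 (0, z) ⟨trivial, hz⟩ Φ (hda Φ hΦ _ ⟨trivial, hz⟩)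
    simp only [e1]
    rw [e3.fderiv_eq]
    have e4 : fderiv ℝ (fun z => fderiv ℝ Φ (0, z) (1, 0)) (ch x₁ y) v =
        fderiv ℝ (fun q => fderiv ℝ Φ q (1, 0)) (0, ch x₁ y) (0, v) := by
      have := (hda _ (hsm (1, 0)) _ (hmem 0)).hasFDerivAt.comp (ch x₁ y)
        (hasFDerivAt_prodMk_right (0 : ℝ) (ch x₁ y))
      exact congrArg (fun L : 𝔼 →L[ℝ] ℝ => L v) this.fderiv
    have e5 : deriv (fun ε : ℝ => fderiv ℝ Φ (ε, ch x₁ y) (0, v)) 0 =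
        fderiv ℝ (fun q => fderiv ℝ Φ q (0, v)) (0, ch x₁ y) (1, 0) :=
      e2 _ (hmem 0) _ (hda _ (hsm (0, v)) _ (hmem 0))
    have hd5 : DifferentiableAt ℝ (fun ε : ℝ => fderiv ℝ Φ (ε, ch x₁ y) (0, v)) 0 :=
      (hda _ (hsm (0, v)) _ (hmem 0)).comp (0 : ℝ)
        (f := fun ε : ℝ => (ε, ch x₁ y)) (by fun_prop)
    rw [deriv_const_mul _ hd5, e5, e4, fderiv_fderiv_comm hO hΦ (hmem 0)]
  · simp [image_eq_zero_of_notMem_tsupport fun h' => hy (hs h')]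

end CartanFields

end JetGeom

namespace JetGeom

open DiffCalc

/-! ### Global cut-off coordinates and the splitting of tangent vectors -/

section CoordinateFunctions

variable {n m : ℕ} {M : Type*} [TopologicalSpace M] [ChartedSpace (EuclideanSpace ℝ (Fin n)) M]
  [IsManifold (𝓡 n) ∞ M]

local notation "𝔼" => EuclideanSpace ℝ (Fin n)
local notation "ch" => chartAt (EuclideanSpace ℝ (Fin n))

theorem exists_bump [T2Space M] {x : M} {U : Set M} (hU : U ∈ nhds x) :
    ∃ χ : M → ℝ, ContMDiff (𝓡 n) 𝓘(ℝ, ℝ) ∞ χ ∧ tsupport χ ⊆ U ∧ ∀ᶠ y in nhds x, χ y = 1 := by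
  obtain ⟨χ, -, hχ⟩ := (SmoothBumpFunction.nhds_basis_tsupport (I := 𝓡 n) x).mem_iff.1 hU
  exact ⟨χ, χ.contMDiff, hχ, χ.eventuallyEq_one⟩

theorem contMDiffOn_smul_of_tsupport {G : Type*} [NormedAddCommGroup G] [NormedSpace ℝ G]
    {χ : M → ℝ} (hχ : ContMDiff (𝓡 n) 𝓘(ℝ, ℝ) ∞ χ) {U W : Set M} (hU : IsOpen U) (hW : IsOpen W)
    (hs : tsupport χ ⊆ W) {h : M → G} (hh : ContMDiffOn (𝓡 n) 𝓘(ℝ, G) ∞ h (U ∩ W)) :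
    ContMDiffOn (𝓡 n) 𝓘(ℝ, G) ∞ (fun y => χ y • h y) U := by
  intro y hy
  refine ContMDiffAt.contMDiffWithinAt ?_
  by_cases hyt : y ∈ tsupport χ
  · exact hχ.contMDiffAt.smul (hh.contMDiffAt ((hU.inter hW).mem_nhds ⟨hy, hs hyt⟩))
  · refine (contMDiffAt_const (c := (0 : G))).congr_of_eventuallyEq ?_
    filter_upwards [(isClosed_tsupport χ).isOpen_compl.mem_nhds hyt] with z hz
    rw [image_eq_zero_of_notMem_tsupport hz, zero_smul]

variable {V : M → Type*} [TopologicalSpace (Bundle.TotalSpace (Fin m → ℝ) V)]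
  [∀ x, TopologicalSpace (V x)] [∀ x, AddCommGroup (V x)] [∀ x, Module ℝ (V x)]
  [FiberBundle (Fin m → ℝ) V] [VectorBundle ℝ (Fin m → ℝ) V]
  [ContMDiffVectorBundle ∞ (Fin m → ℝ) V (𝓡 n)]

/-- The pullback of a function on the base. -/
def baseFun {h : M → ℝ} (hh : ContMDiff (𝓡 n) 𝓘(ℝ, ℝ) ∞ h) : JetFun n m V :=
  ⟨fun ρ => h ρ.base, mem_jetFun_iff.2 ⟨0, isOfOrder_base hh⟩⟩

variable {x₁ : M} {χ : M → ℝ}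

theorem contMDiff_baseCoord (hχ : ContMDiff (𝓡 n) 𝓘(ℝ, ℝ) ∞ χ)
    (hs : tsupport χ ⊆ adaptedDom n m V x₁)
    (a : Fin n) :
    ContMDiff (𝓡 n) 𝓘(ℝ, ℝ) ∞ fun y => χ y * ch x₁ y a := by
  refine contMDiffOn_univ.1 (contMDiffOn_smul_of_tsupport hχ isOpen_univ
    (isOpen_adaptedDom V x₁) hs (h := fun y => ch x₁ y a) ?_)
  rw [Set.univ_inter]
  have h1 : ContDiff ℝ ∞ fun z : 𝔼 => z a := contDiff_piLp_apply 2
  exact h1.contMDiff.comp_contMDiffOn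
    ((contMDiffOn_chart (I := 𝓡 n) (x := x₁) (n := ∞)).mono (adaptedDom_subset_source V x₁))

/-- Passing from one trivialization to the other is linear with smooth coefficients, which the
cut-off extends by zero. No derivative of the section enters. -/
theorem isOfOrder_fibreCoord (hχ : ContMDiff (𝓡 n) 𝓘(ℝ, ℝ) ∞ χ)
    (hs : tsupport χ ⊆ adaptedDom n m V x₁)
    (i : Fin m) : IsOfOrder 0 fun y (σ : Sec n m V) =>
    χ y * (trivializationAt (Fin m → ℝ) V x₁ ⟨y, σ y⟩).2 i := by
  intro x₀
  set e₀ := trivializationAt (Fin m → ℝ) V x₀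
  set e₁ := trivializationAt (Fin m → ℝ) V x₁
  have hC := contDiffOn_comp_chart_symm x₀ (adaptedDom_subset_source V x₀)
    (contMDiffOn_smul_of_tsupport hχ (isOpen_adaptedDom V x₀) (isOpen_adaptedDom V x₁) hs
      (h := fun y => (e₀.coordChangeL ℝ e₁ y : (Fin m → ℝ) →L[ℝ] (Fin m → ℝ)))
      ((contMDiffOn_coordChangeL (n := ∞) (IB := 𝓡 n) e₀ e₁).mono
        fun y hy => ⟨hy.1.2, hy.2.2⟩))
  have h0 : (0 : Fin n → ℕ) ∈ multiIdx n 0 := by simp [multiIdx]; rfl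
  refine ⟨fun p => (χ ((ch x₀).symm p.1) •
    (e₀.coordChangeL ℝ e₁ ((ch x₀).symm p.1) : (Fin m → ℝ) →L[ℝ] (Fin m → ℝ)))
      (fun j => p.2 j ⟨0, h0⟩) i, ?_, fun y hy σ => ?_⟩
  · refine contDiffOn_pi.1 (ContDiffOn.clm_apply (hC.comp contDiffOn_fst fun p hp => hp.1)
      (ContDiff.contDiffOn (by fun_prop))) i
  · have h1 : (fun j => jetVec 0 x₀ σ (ch x₀ y) j ⟨0, h0⟩) = (e₀ ⟨y, σ y⟩).2 := by
      funext j
      rw [jetVec, iterOps_zero, localComp_chart hy]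
    simp only [h1, (ch x₀).left_inv hy.1]
    by_cases hy1 : y ∈ adaptedDom n m V x₁
    · have h2 : e₀.coordChangeL ℝ e₁ y (e₀ ⟨y, σ y⟩).2 = (e₁ ⟨y, σ y⟩).2 := by
        rw [e₀.coordChangeL_apply e₁ ⟨hy.2, hy1.2⟩, e₀.symm_apply_apply_mk hy.2]
      exact congrArg (χ y * ·) (congrFun h2 i).symm
    · simp [image_eq_zero_of_notMem_tsupport fun h' => hy1 (hs h')]

/-- The coordinate `uⁱ` around `x₁`, cut off. -/
noncomputable def fibreCoord (hχ : ContMDiff (𝓡 n) 𝓘(ℝ, ℝ) ∞ χ)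
    (hs : tsupport χ ⊆ adaptedDom n m V x₁)
    (i : Fin m) : JetFun n m V :=
  ⟨descend _, descend_mem_jetFun (isOfOrder_fibreCoord hχ hs i)⟩

theorem fibreCoord_apply (hχ : ContMDiff (𝓡 n) 𝓘(ℝ, ℝ) ∞ χ)
    (hs : tsupport χ ⊆ adaptedDom n m V x₁)
    (i : Fin m) (y : M) (σ : Sec n m V) :
    (fibreCoord hχ hs i).1 (jet y σ) = χ y * (trivializationAt (Fin m → ℝ) V x₁ ⟨y, σ y⟩).2 i :=
  descend_jet (isOfOrder_fibreCoord hχ hs i) y σ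

/-- The coordinate `uⁱ_α` around `x₁`, cut off. -/
noncomputable def jetCoordFun (hχ : ContMDiff (𝓡 n) 𝓘(ℝ, ℝ) ∞ χ)
    (hs : tsupport χ ⊆ adaptedDom n m V x₁)
    (i : Fin m) (α : Fin n → ℕ) : JetFun n m V :=
  iterOps (fun j f => cartanField hχ hs (EuclideanSpace.single j 1) f) α (fibreCoord hχ hs i)

/-- Where χ = 1 the cut-off total derivatives become ordinary partial derivatives along a section.
The equality holds on an open set, so it may be differentiated at each step. -/
theorem jetCoordFun_apply (hχ : ContMDiff (𝓡 n) 𝓘(ℝ, ℝ) ∞ χ)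
    (hs : tsupport χ ⊆ adaptedDom n m V x₁)
    {N : Set M} (hN : IsOpen N) (hN1 : N ⊆ adaptedDom n m V x₁)
    (hNχ : ∀ y ∈ N, χ y = 1) (i : Fin m) (α : Fin n → ℕ) {y : M} (hy : y ∈ N) (σ : Sec n m V) :
    (jetCoordFun hχ hs i α).1 (jet y σ) = jetCoord n m V x₁ σ y i α := by
  have hO := isOpen_coordDom (n := n) (m := m) V x₁
  have key := iterOps_rel (T := fun j f => cartanField hχ hs (EuclideanSpace.single j 1) f)
    (T' := basePartial) (fun f h => ContDiffOn ℝ ∞ h (coordDom n m V x₁) ∧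
      ∀ y ∈ N, f.1 (jet y σ) = h (ch x₁ y)) ?_ α (b := fibreCoord hχ hs i)
      (c := localComp x₁ σ i) ⟨contDiffOn_localComp x₁ σ i, fun y hy => ?_⟩
  · exact key.2 y hy
  · rintro j f h ⟨hh, hf⟩
    refine ⟨contDiffOn_basePartial hO hh j, fun y hy => ?_⟩
    have heq : (fun z => f.1 (jet ((ch x₁).symm z) σ)) =ᶠ[nhds (ch x₁ y)] h := by
      filter_upwards [((ch x₁).isOpen_image_of_subset_source hN
        (hN1.trans (adaptedDom_subset_source V x₁))).mem_nhds ⟨y, hy, rfl⟩] with z hz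
      obtain ⟨q, hq, rfl⟩ := hz
      rw [(ch x₁).left_inv (hN1 hq).1, hf q hq]
    rw [cartanField_apply, hNχ y hy, one_mul, heq.fderiv_eq,
      basePartial_eq_fderiv hO hh (chart_mem_coordDom (hN1 hy))]
  · rw [fibreCoord_apply, hNχ y hy, one_mul, localComp_chart (hN1 hy)]

theorem exists_open_eq_one (hχ1 : ∀ᶠ y in nhds x₁, χ y = 1) :
    ∃ N : Set M, IsOpen N ∧ x₁ ∈ N ∧ N ⊆ adaptedDom n m V x₁ ∧
    ∀ y ∈ N, χ y = 1 := by
  obtain ⟨N, hN, hNo, hx⟩ := eventually_nhds_iff.1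
    (hχ1.and ((isOpen_adaptedDom (n := n) (m := m) V x₁).mem_nhds (mem_adaptedDom_self V x₁)))
  exact ⟨N, hNo, hx, fun y hy => (hN y hy).2, fun y hy => (hN y hy).1⟩

/-- A tangent vector is determined by its values on the coordinate functions. -/
theorem exists_derivation_formula [T2Space M] (hχ : ContMDiff (𝓡 n) 𝓘(ℝ, ℝ) ∞ χ)
    (hs : tsupport χ ⊆ adaptedDom n m V x₁)
    (hχ1 : ∀ᶠ y in nhds x₁, χ y = 1)
    (f : JetFun n m V) (ρ : Jet n m V)
    (hρ : ρ.base = x₁) :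
    ∃ (k : ℕ) (c : Fin n → ℝ) (c' : Fin m → multiIdx n k → ℝ), ∀ X : JetField n m V,
      (X f).1 ρ = ∑ a, c a * (X (baseFun (contMDiff_baseCoord hχ hs a))).1 ρ +
        ∑ i, ∑ α, c' i α * (X (jetCoordFun hχ hs i α)).1 ρ := by
  obtain ⟨N, hN, hxN, hN1, hNχ⟩ := exists_open_eq_one (n := n) (m := m) (V := V) hχ1
  obtain ⟨k, hk⟩ := exists_rep f
  obtain ⟨g, hg, hfg⟩ := hk x₁
  -- The representative `g` is smooth only over the chart; κ makes it globally smooth, as the chain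
  -- rule requires, without changing it near x₁.
  obtain ⟨κ, hκ, hκs, hκ1⟩ := exists_bump (n := n) ((isOpen_coordDom (n := n) (m := m) V x₁).mem_nhds
    (chart_mem_coordDom (mem_adaptedDom_self (m := m) V x₁)))
  have hκ' : ContDiff ℝ ∞ κ := contMDiff_iff_contDiff.1 hκ
  have hH0 : ContDiff ℝ ∞ fun p : 𝔼 × (Fin m → multiIdx n k → ℝ) => κ p.1 * g p := by
    refine contDiff_iff_contDiffAt.2 fun p => ?_
    by_cases hp : p.1 ∈ tsupport κ
    · exact (hκ'.comp contDiff_fst).contDiffAt.mul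
        (hg.contDiffAt ((isOpen_coordDom_prod x₁ k).mem_nhds ⟨hκs hp, trivial⟩))
    · refine (contDiffAt_const (c := (0 : ℝ))).congr_of_eventuallyEq ?_
      filter_upwards [continuous_fst.continuousAt.eventually
        ((isClosed_tsupport κ).isOpen_compl.mem_nhds hp)] with q hq
      rw [image_eq_zero_of_notMem_tsupport hq, zero_mul]
  set H : ((Fin n ⊕ (Fin m × multiIdx n k)) → ℝ) → ℝ := fun z =>
    κ (WithLp.toLp 2 fun a => z (Sum.inl a)) *
      g (WithLp.toLp 2 (fun a => z (Sum.inl a)), fun i α => z (Sum.inr (i, α))) with hHdef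
  have hH : ContDiff ℝ ∞ H := hH0.comp (f := fun z : (Fin n ⊕ (Fin m × multiIdx n k)) → ℝ =>
    ((WithLp.toLp 2 (fun a => z (Sum.inl a)) : 𝔼), fun i α => z (Sum.inr (i, α))))
    (by fun_prop)
  set G : Fin n ⊕ (Fin m × multiIdx n k) → JetFun n m V := Sum.elim
    (fun a => baseFun (contMDiff_baseCoord hχ hs a)) (fun q => jetCoordFun hχ hs q.1 q.2) with hGdef
  obtain ⟨c, hc⟩ := exists_chain_rule G hH ρ
  set f' : JetFun n m V := ⟨_, exists_comp_mem_jetFun G hH⟩ with hf'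
  have hev : ∀ᶠ y in nhds x₁, ∀ σ : Sec n m V, f.1 (jet y σ) = f'.1 (jet y σ) := by
    filter_upwards [hN.mem_nhds hxN,
      ((ch x₁).continuousAt (mem_chart_source _ x₁)).eventually hκ1] with y hy hy1 σ
    have e1 : (WithLp.toLp 2 (fun a => (G (Sum.inl a)).1 (jet y σ)) : 𝔼) = ch x₁ y := by
      ext a
      change χ y * ch x₁ y a = _
      rw [hNχ y hy, one_mul]
    have e2 : (fun i α => (G (Sum.inr (i, α))).1 (jet y σ)) = jetVec k x₁ σ (ch x₁ y) := by
      funext i α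
      exact jetCoordFun_apply hχ hs hN hN1 hNχ i α hy σ
    change _ = κ _ * g (_, _)
    rw [e1, e2, hy1, one_mul, ← hfg _ (chart_mem_coordDom (hN1 hy)), (ch x₁).left_inv (hN1 hy).1]
  -- Derivations are local: ψ (f − f') is identically zero, and Leibniz at `ρ`, where ψ = 1 and f =
  -- f', gives X f = X f' there.
  obtain ⟨ψ, hψ, hψs, hψ1⟩ := exists_bump (n := n) hev
  have hzero : baseFun hψ * (f - f') = 0 := by
    refine jetFun_ext fun y σ => ?_
    change ψ y * (f.1 (jet y σ) - f'.1 (jet y σ)) = 0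
    by_cases hy : y ∈ tsupport ψ
    · rw [hψs hy σ, sub_self, mul_zero]
    · rw [image_eq_zero_of_notMem_tsupport hy, zero_mul]
  refine ⟨k, fun a => c (Sum.inl a), fun i α => c (Sum.inr (i, α)), fun X => ?_⟩
  have h1 : evalAt ρ (X (baseFun hψ * (f - f'))) = 0 := by rw [hzero, map_zero, map_zero]
  rw [Derivation.leibniz, smul_eq_mul, smul_eq_mul, map_add, map_mul, map_mul, map_sub, map_sub,
    map_sub] at h1
  have h2 : evalAt ρ (baseFun hψ) = 1 := by
    change ψ ρ.base = 1
    rw [hρ]; exact hψ1.self_of_nhds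
  have h3 : evalAt ρ f - evalAt ρ f' = 0 := by
    obtain ⟨σ, hσ⟩ := exists_jet_eq ρ
    rw [evalAt_apply, evalAt_apply, ← hσ, hρ, hev.self_of_nhds σ, sub_self]
  rw [h2, h3, zero_mul, add_zero, one_mul, sub_eq_zero] at h1
  refine h1.trans ((hc X).trans ?_)
  rw [Fintype.sum_sum_type, Fintype.sum_prod_type]
  rfl

/-- Every jet of finite order is the jet of a section. -/
theorem exists_section_jetCoord (hχ : ContMDiff (𝓡 n) 𝓘(ℝ, ℝ) ∞ χ)
    (hs : tsupport χ ⊆ adaptedDom n m V x₁)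
    (hχ1 : ∀ᶠ y in nhds x₁, χ y = 1)
    (k : ℕ) (c : Fin m → (Fin n → ℕ) → ℝ) :
    ∃ τ : Sec n m V, ∀ i, ∀ α ∈ multiIdx n k, jetCoord n m V x₁ τ x₁ i α = c i α := by
  obtain ⟨N, hN, hxN, hN1, hNχ⟩ := exists_open_eq_one (n := n) (m := m) (V := V) hχ1
  choose h hh hα using fun i => exists_iterOps_basePartial_eq (ch x₁ x₁) k (c i)
  set e := trivializationAt (Fin m → ℝ) V x₁
  have hsm : ContMDiffOn (𝓡 n) ((𝓡 n).prod 𝓘(ℝ, Fin m → ℝ)) ∞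
      (fun y => Bundle.TotalSpace.mk' (Fin m → ℝ) y (e.symm y fun i => h i (ch x₁ y)))
      (adaptedDom n m V x₁) := by
    rw [e.contMDiffOn_section_iff (isOpen_adaptedDom V x₁) Set.inter_subset_right]
    have h1 : ContDiff ℝ ∞ fun z i => h i z := contDiff_pi.2 hh
    refine (h1.contMDiff.comp_contMDiffOn ((contMDiffOn_chart (I := 𝓡 n) (x := x₁)
      (n := ∞)).mono (adaptedDom_subset_source V x₁))).congr fun y hy => ?_
    rw [e.apply_mk_symm hy.2]
    rfl
  -- The polynomial local section is cut off by χ; since χ = 1 near x₁ the derivatives there are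
  -- unchanged.
  refine ⟨⟨χ • fun y => e.symm y fun i => h i (ch x₁ y), ContMDiffOn.smul_section_of_tsupport
    hχ.contMDiffOn (isOpen_adaptedDom V x₁) hs hsm⟩, fun i α hαk => ?_⟩
  rw [← hα i α hαk]
  have hNo := (ch x₁).isOpen_image_of_subset_source hN (hN1.trans (adaptedDom_subset_source V x₁))
  refine iterOps_basePartial_congr hNo (h := localComp x₁ _ i) (fun z hz => ?_) α ⟨x₁, hxN, rfl⟩
  obtain ⟨y, hy, rfl⟩ := hz
  rw [localComp_chart (hN1 hy)]
  change (e ⟨y, χ y • e.symm y fun i => h i (ch x₁ y)⟩).2 i = _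
  rw [hNχ y hy, one_smul, e.apply_mk_symm (hN1 hy).2]

/-- At each jet, a vector field is the sum of a field in the Cartan distribution and of an
evolutionary field, on functions of bounded order. -/
theorem exists_decomposition [T2Space M] (hχ : ContMDiff (𝓡 n) 𝓘(ℝ, ℝ) ∞ χ)
    (hs : tsupport χ ⊆ adaptedDom n m V x₁)
    (hχ1 : ∀ᶠ y in nhds x₁, χ y = 1)
    (X : JetField n m V) (ρ : Jet n m V) (hρ : ρ.base = x₁)
    (T : Finset (JetFun n m V)) : ∃ (v : 𝔼) (τ : Sec n m V), ∀ f ∈ T,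
      evalAt ρ (X f) = evalAt ρ (cartanField hχ hs v f) + evalAt ρ (translationField τ f) := by
  choose k c c' hf using fun f : JetFun n m V => exists_derivation_formula hχ hs hχ1 f ρ hρ
  obtain ⟨N, hN, hxN, hN1, hNχ⟩ := exists_open_eq_one (n := n) (m := m) (V := V) hχ1
  obtain ⟨σ, hσ⟩ := exists_jet_eq ρ
  rw [hρ] at hσ
  -- The Cartan part is fixed by the base components of `X`. Then τ is chosen so that its jet fills
  -- in the remaining fibre components, up to the largest order needed for the finite set `T`.
  set v : 𝔼 := WithLp.toLp 2 fun a => (X (baseFun (contMDiff_baseCoord hχ hs a))).1 ρ with hv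
  obtain ⟨τ, hτ⟩ := exists_section_jetCoord hχ hs hχ1 (T.sup k) fun i α =>
    (X (jetCoordFun hχ hs i α)).1 ρ - (cartanField hχ hs v (jetCoordFun hχ hs i α)).1 ρ
  have h1 : ∀ a, (cartanField hχ hs v (baseFun (contMDiff_baseCoord hχ hs a))).1 ρ =
      (X (baseFun (contMDiff_baseCoord hχ hs a))).1 ρ := by
    intro a
    rw [← hσ, cartanField_apply, hNχ x₁ hxN, one_mul]
    have heq : (fun z => (baseFun (contMDiff_baseCoord hχ hs a) : JetFun n m V).1
        (jet ((ch x₁).symm z) σ)) =ᶠ[nhds (ch x₁ x₁)] fun z => z a := by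
      filter_upwards [((ch x₁).isOpen_image_of_subset_source hN
        (hN1.trans (adaptedDom_subset_source V x₁))).mem_nhds ⟨x₁, hxN, rfl⟩] with z hz
      obtain ⟨q, hq, rfl⟩ := hz
      change χ ((ch x₁).symm (ch x₁ q)) * ch x₁ ((ch x₁).symm (ch x₁ q)) a = _
      rw [(ch x₁).left_inv (hN1 hq).1, hNχ q hq, one_mul]
    rw [heq.fderiv_eq, hσ]
    exact congrArg (fun L : 𝔼 →L[ℝ] ℝ => L v)
      (EuclideanSpace.proj a : 𝔼 →L[ℝ] ℝ).hasFDerivAt.fderiv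
  have h2 : ∀ a, (translationField τ (baseFun (contMDiff_baseCoord hχ hs a))).1 ρ = 0 := fun a =>
    isVerticalAt_translationField τ ρ _ fun ρ₁ ρ₂ h => by
      change χ ρ₁.base * _ = χ ρ₂.base * _
      rw [h]
  have h3 : ∀ i, ∀ α ∈ multiIdx n (T.sup k), (translationField τ (jetCoordFun hχ hs i α)).1 ρ =
      (X (jetCoordFun hχ hs i α)).1 ρ - (cartanField hχ hs v (jetCoordFun hχ hs i α)).1 ρ := by
    intro i α hα
    rw [← hτ i α hα]
    conv_lhs => rw [← hσ]
    rw [translationField_apply]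
    have : ∀ ε : ℝ, (jetCoordFun hχ hs i α).1 (jet x₁ (σ + ε • τ)) =
        jetCoord n m V x₁ σ x₁ i α + ε * jetCoord n m V x₁ τ x₁ i α := by
      intro ε
      rw [jetCoordFun_apply hχ hs hN hN1 hNχ i α hxN]
      exact congrFun (congrFun (jetVec_add_smul (T.sup k) σ τ ε
        (chart_mem_coordDom (mem_adaptedDom_self V x₁))) i) ⟨α, hα⟩
    simp only [this]
    simp
  refine ⟨v, τ, fun f hfT => ?_⟩
  simp only [evalAt_apply]
  rw [hf f X, hf f (cartanField hχ hs v), hf f (translationField τ)]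
  simp only [h1, h2, mul_zero, Finset.sum_const_zero, zero_add]
  rw [add_assoc, ← Finset.sum_add_distrib]
  congr 1
  refine Finset.sum_congr rfl fun i _ => ?_
  rw [← Finset.sum_add_distrib]
  refine Finset.sum_congr rfl fun α _ => ?_
  rw [h3 i α (multiIdx_mono (Finset.le_sup hfT) α.2)]
  ring

end CoordinateFunctions

end JetGeom

/-! ### Cartan's formula and vanishing criteria for forms -/

namespace DiffCalc

/-- Cartan's formula in a form valid in every degree: in degree zero `extDContract` is zero by
convention. -/
theorem extD_cons {A : Type*} [CommRing A] [Algebra ℝ A] {k : ℕ} (θ : Cochain A k)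
    (X : Derivation ℝ A A) (Y : Fin k → Derivation ℝ A A) :
    extD k θ (Fin.cons X Y) = lieDer X θ Y - extDContract X θ Y := by
  cases k with
  | zero => simp [extD, lieDer, extDContract]
  | succ k => rfl

section Algebra

variable {A : Type*} [CommRing A] [Algebra ℝ A]

theorem extDContract_eq_zero {k : ℕ} {θ : Cochain A k} {X : Derivation ℝ A A}
    (h : ∀ Y : Fin k → Derivation ℝ A A, (∃ i, Y i = X) → θ Y = 0) : extDContract X θ = 0 := by
  cases k with
  | zero => rfl
  | succ k =>
    have : contract X θ = 0 := funext fun Z => h _ ⟨0, rfl⟩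
    rw [extDContract, this]
    simpa using extD_smul k 0 (0 : Cochain A k)

theorem extD_add_cons {k : ℕ} {L θ : Cochain A k} {X : Derivation ℝ A A}
    {Y : Fin k → Derivation ℝ A A} (hθ : lieDer X θ Y = 0) (hL : extDContract X L = 0) :
    extD k (L + θ) (Fin.cons X Y) = lieDer X L Y - extDContract X θ Y := by
  rw [extD_add, Pi.add_apply, extD_cons, extD_cons, hθ, hL, Pi.zero_apply, sub_zero, zero_sub,
    sub_eq_add_neg]

/-- The vanishing of `θ Y` is an identity of functions, so it survives differentiation by `X`; each
other term has a zero bracket among its arguments. -/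
theorem lieDer_apply_eq_zero {k : ℕ} {θ : Cochain A k} (h : θ ∈ Forms A k) {X : Derivation ℝ A A}
    {Y : Fin k → Derivation ℝ A A} (hY : θ Y = 0) (hXY : ∀ a, ⁅X, Y a⁆ = 0) :
    lieDer X θ Y = 0 := by
  rw [lieDer, hY, map_zero, zero_sub, neg_eq_zero]
  refine Finset.sum_eq_zero fun a _ => forms_apply_eq_zero h _ a ?_
  rw [Function.update_self, hXY]

/-- To check that a form is zero when all but one of its arguments are in a given set, one may take
the exceptional argument to be the first. -/
theorem forms_apply_eq_zero_of_first {B : Type*} [CommRing B] (ev : A →+* B) {n : ℕ}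
    {η : Cochain A (n + 1)} (hη : η ∈ Forms A (n + 1)) (P : Derivation ℝ A A → Prop)
    (hfirst : ∀ X : Fin (n + 1) → Derivation ℝ A A, (∀ a : Fin n, P (X a.succ)) → ev (η X) = 0)
    (X : Fin (n + 1) → Derivation ℝ A A) (s : Finset (Fin (n + 1))) (hs : n ≤ s.card)
    (hX : ∀ i ∈ s, P (X i)) : ev (η X) = 0 := by
  obtain ⟨i, hi⟩ : ∃ i, ∀ j, j ≠ i → P (X j) := by
    by_cases h : ∃ i, i ∉ s
    · obtain ⟨i, hi⟩ := h
      refine ⟨i, fun j hj => hX j ?_⟩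
      by_contra hjs
      -- Two indices outside `s` would leave at most n − 1 inside it.
      have h1 : ({i, j} : Finset (Fin (n + 1))) ⊆ sᶜ := by
        intro a ha
        rcases Finset.mem_insert.1 ha with rfl | ha
        · simpa using hi
        · rw [Finset.mem_singleton.1 ha]; simpa using hjs
      have h2 := Finset.card_le_card h1
      rw [Finset.card_pair hj.symm, Finset.card_compl, Fintype.card_fin] at h2
      omega
    · push Not at h
      exact ⟨0, fun j _ => hX j (h j)⟩
  have hsw := forms_apply_comp_perm hη (X ∘ Equiv.swap 0 i) (Equiv.swap 0 i)
  have hXX : (X ∘ Equiv.swap 0 i) ∘ Equiv.swap 0 i = X := by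
    funext a
    simp
  rw [hXX] at hsw
  rw [hsw, map_mul, hfirst, mul_zero]
  intro a
  refine hi _ fun h => ?_
  have := (Equiv.swap 0 i).injective (h.trans (Equiv.swap_apply_left 0 i).symm)
  exact Fin.succ_ne_zero a this

theorem restrictForm_surjective (I : Ideal A) (k : ℕ) :
    Function.Surjective (restrictForm I k) := Submodule.mkQ_surjective _

end Algebra

end DiffCalc

namespace JetGeom

open DiffCalc

/-! ### The differential of L + θ at the jets where E(L) vanishes -/

section Presymplectic

variable {n m : ℕ} {M : Type*} [TopologicalSpace M] [ChartedSpace (EuclideanSpace ℝ (Fin n)) M]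
  [IsManifold (𝓡 n) ∞ M] {V : M → Type*} [TopologicalSpace (Bundle.TotalSpace (Fin m → ℝ) V)]
  [∀ x, TopologicalSpace (V x)] [∀ x, AddCommGroup (V x)] [∀ x, Module ℝ (V x)]
  [FiberBundle (Fin m → ℝ) V] [VectorBundle ℝ (Fin m → ℝ) V]
  [ContMDiffVectorBundle ∞ (Fin m → ℝ) V (𝓡 n)]

/-- A form of degree greater than `n` is zero on the Cartan planes. -/
theorem inCartanPowAt_one_of_degree_gt {η : Cochain (JetFun n m V) (n + 1)}
    (hη : η ∈ Forms (JetFun n m V) (n + 1)) (ρ : Jet n m V) : InCartanPowAt 1 η ρ := by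
  intro X s hcard hX
  have hs : s = Finset.univ := Finset.eq_univ_of_card s
    (le_antisymm (Finset.card_le_univ s) (by rw [Fintype.card_fin]; omega))
  obtain ⟨v, hv⟩ : ∃ v : Fin (n + 1) → EuclideanSpace ℝ (Fin n), ∀ i, IsLiftAt (X i) ρ (v i) :=
    Classical.axiomOfChoice fun i => hX i (hs ▸ Finset.mem_univ i)
  obtain ⟨σ, hσ⟩ := exists_jet_eq ρ
  have hdep : ¬ LinearIndependent ℝ v := fun h => by
    have := h.fintype_card_le_finrank
    simp at this
  obtain ⟨c, hc, i, hi⟩ := Fintype.not_linearIndependent_iff.1 hdep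
  refine forms_apply_eq_zero_of_dependent hη (evalAt ρ) X c (fun h => hi (by rw [h]; rfl))
    fun f => ?_
  -- The Cartan vectors act on `f` through the linear map ℓ, so a relation between their projections
  -- to M is a relation between their values on every function.
  let ℓ : EuclideanSpace ℝ (Fin n) →L[ℝ] ℝ :=
    mfderiv (𝓡 n) 𝓘(ℝ, ℝ) (fun y => f.1 (jet y σ)) ρ.base
  have h : ∀ a, evalAt ρ (X a f) = ℓ (v a) := fun a => hv a ρ.base σ hσ f
  have h' := congrArg ℓ hc
  rw [map_sum, map_zero] at h'
  simpa only [h, map_smul, smul_eq_mul] using h'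

/-- `L + θ` is closed, along the evolutionary fields and the Cartan distribution, at the jets where
the variational derivative of `L` is zero. -/
theorem evalAt_extD_translationField_cons {L θ : Cochain (JetFun n m V) n}
    (hθF : θ ∈ Forms (JetFun n m V) n) (hL : IsHorizontal L)
    (hθ : IsNoetherForm L θ) {ρ : Jet n m V} (hE : ∀ w v, eulerForm L ρ w v = 0)
    {χ : M → ℝ} (hχ : ContMDiff (𝓡 n) 𝓘(ℝ, ℝ) ∞ χ)
    (hs : tsupport χ ⊆ adaptedDom n m V ρ.base) (hχ1 : χ ρ.base = 1) (τ : Sec n m V)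
    (v : Fin n → EuclideanSpace ℝ (Fin n)) :
    evalAt ρ (extD n (L + θ) (Fin.cons (translationField τ)
        fun a => cartanField hχ hs (v a))) = 0 := by
  let Y : Fin n → JetField n m V := fun a => cartanField hχ hs (v a)
  -- The fields Y_a are Cartan at every jet, not only at `ρ`, so θ vanishes on them identically.
  have h1 : lieDer (translationField τ) θ Y = 0 :=
    lieDer_apply_eq_zero hθF (jetFun_ext fun x σ => hθ.1 (jet x σ) Y Finset.univ (by simp)
      fun a _ => isCartanAt_cartanField hχ hs (v a) (jet x σ))
      fun a => lie_translationField_cartanField hχ hs (v a) τ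
  have h2 : extDContract (translationField τ) L = 0 := extDContract_eq_zero fun Z hZ =>
    jetFun_ext fun x σ => hL Z (jet x σ) (by
      obtain ⟨i, hi⟩ := hZ
      exact ⟨i, by rw [hi]; exact isVerticalAt_translationField τ _⟩)
  -- The Noether identity at `ρ`, where χ = 1 and so Y_a lifts v a; its Euler term is then killed by
  -- `hE`.
  have h3 := hθ.2.2 (pullbackSection τ) (translationField τ) (isEvolutionary_translationField τ)
    ρ Y v fun a => isLiftAt_cartanField hχ hs (v a) hχ1 ρ rfl
  replace h3 := h3.trans ((congrArg (· + _) (hE _ v)).trans (zero_add _))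
  rw [extD_add_cons h1 h2, map_sub, sub_eq_zero]
  exact h3

/-- The differential of `L + θ` is in the square of the Cartan ideal at the jets where the
variational derivative of `L` is zero. -/
theorem inCartanPowAt_two_extD [T2Space M] {L θ : Cochain (JetFun n m V) n}
    (hLF : L ∈ Forms (JetFun n m V) n) (hθF : θ ∈ Forms (JetFun n m V) n) (hL : IsHorizontal L)
    (hθ : IsNoetherForm L θ) {ρ : Jet n m V} (hE : ∀ w v, eulerForm L ρ w v = 0) :
    InCartanPowAt 2 (extD n (L + θ)) ρ := by
  have hη := extD_mem_forms (Submodule.add_mem _ hLF hθF)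
  obtain ⟨χ, hχ, hs, hχ1⟩ := exists_bump (n := n) ((isOpen_adaptedDom (n := n) (m := m) V
    ρ.base).mem_nhds (mem_adaptedDom_self V ρ.base))
  obtain ⟨T, hT⟩ := exists_finset_of_mem_forms hη
  have hzero : ∀ X : Fin (n + 1) → JetField n m V, (∀ i, IsCartanAt (X i) ρ) →
      evalAt ρ (extD n (L + θ) X) = 0 := fun X hX =>
    inCartanPowAt_one_of_degree_gt hη ρ X Finset.univ (by simp) fun i _ => hX i
  have hfirst : ∀ X : Fin (n + 1) → JetField n m V, (∀ a : Fin n, IsCartanAt (X a.succ) ρ) →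
      evalAt ρ (extD n (L + θ) X) = 0 := by
    intro X hX
    choose v hv using hX
    obtain ⟨w, τ, hdec⟩ := exists_decomposition hχ hs hχ1 (X 0) ρ rfl T
    rw [(hT (evalAt ρ)).2 X (Fin.cons (cartanField hχ hs w) (Fin.tail X))
      (Fin.cons (translationField τ) (Fin.tail X)) 0 ?_ hdec]
    -- The Cartan part of the exceptional argument gives zero. In the vertical part only values at
    -- `ρ` matter, so the given Cartan arguments may be exchanged for lifts of the same vectors that
    -- commute with the translation.
    · rw [hzero, zero_add,
        ← evalAt_extD_translationField_cons hθF hL hθ hE hχ hs hχ1.self_of_nhds τ v]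
      · refine (hT (evalAt ρ)).1 _ _ fun a t _ => ?_
        refine Fin.cases rfl (fun a => ?_) a
        obtain ⟨σ, hσ⟩ := exists_jet_eq ρ
        have h1 := hv a ρ.base σ hσ t
        have h2 := isLiftAt_cartanField hχ hs (v a) hχ1.self_of_nhds ρ rfl ρ.base σ hσ t
        exact h1.trans h2.symm
      · exact Fin.cases (isCartanAt_cartanField hχ hs w ρ) fun a => ⟨v a, hv a⟩
    · intro j hj
      obtain ⟨a, rfl⟩ := Fin.exists_succ_eq.2 hj
      exact ⟨rfl, rfl⟩
  exact fun X s hcard hX => forms_apply_eq_zero_of_first (evalAt ρ) hη (fun X => IsCartanAt X ρ)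
    hfirst X s (by omega) hX

theorem cartanFiltration_succ_le (S : Set (Jet n m V)) (p k : ℕ) :
    cartanFiltration S (p + 1) k ≤ cartanFiltration S p k :=
  Submodule.map_mono fun _ hθ ρ hρ X s hs hX => hθ ρ hρ X s (by omega) hX

theorem restrictForm_mem_cartanFiltration {S : Set (Jet n m V)} {p k : ℕ}
    {θ : Forms (JetFun n m V) k} (hθ : ∀ ρ ∈ S, InCartanPowAt p θ.1 ρ) :
    restrictForm (vanishingIdeal S) k θ ∈ cartanFiltration S p k :=
  Submodule.mem_map_of_mem hθ

theorem cartanFiltration_eq_top {S : Set (Jet n m V)} {p k : ℕ}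
    (h : ∀ θ : Forms (JetFun n m V) k, ∀ ρ ∈ S, InCartanPowAt p θ.1 ρ) :
    cartanFiltration S p k = ⊤ := by
  refine eq_top_iff.2 fun x _ => ?_
  obtain ⟨θ, rfl⟩ := restrictForm_surjective _ _ x
  exact restrictForm_mem_cartanFiltration (h θ)

/-- For p = 0 the condition speaks of k + 1 indices among k, so it is empty. -/
theorem cartanFiltration_zero (S : Set (Jet n m V)) (k : ℕ) : cartanFiltration S 0 k = ⊤ :=
  cartanFiltration_eq_top fun _ _ _ _ s hs _ => by
    have := s.card_le_univ
    rw [Fintype.card_fin] at this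
    omega

end Presymplectic

end JetGeom

theorem theorem2 {n m l : ℕ} {M : Type*} [TopologicalSpace M] [T2Space M]
    [SecondCountableTopology M] [ChartedSpace (EuclideanSpace ℝ (Fin n)) M]
    [IsManifold (𝓡 n) ∞ M]
    (V : M → Type*) [TopologicalSpace (Bundle.TotalSpace (Fin m → ℝ) V)]
    [∀ x, TopologicalSpace (V x)] [∀ x, AddCommGroup (V x)] [∀ x, Module ℝ (V x)]
    [FiberBundle (Fin m → ℝ) V] [VectorBundle ℝ (Fin m → ℝ) V]
    [ContMDiffVectorBundle ∞ (Fin m → ℝ) V (𝓡 n)]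
    (W : M → Type*) [TopologicalSpace (Bundle.TotalSpace (Fin l → ℝ) W)]
    [∀ x, TopologicalSpace (W x)] [∀ x, AddCommGroup (W x)] [∀ x, Module ℝ (W x)]
    [FiberBundle (Fin l → ℝ) W] [VectorBundle ℝ (Fin l → ℝ) W]
    [ContMDiffVectorBundle ∞ (Fin l → ℝ) W (𝓡 n)]
    (F : JetGeom.JetSection n m V l W) (S : Set (JetGeom.Jet n m V))
    (hS : S = JetGeom.prolongation F)
    (L θ : JetGeom.JetForms n m V n) (hL : JetGeom.IsHorizontal L.1)
    (hθ : JetGeom.IsNoetherForm L.1 θ.1) (hE : JetGeom.EulerVanishesOn L.1 S) :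
    (∃ (Ω : JetGeom.VinE S 1 2 (n + 1)) (e : JetGeom.VinE S 2 2 (n + 1)),
      JetGeom.IsPresymplectic S L θ Ω ∧ JetGeom.vinD S 1 2 (n + 1) Ω = 0 ∧
        DiffCalc.Represents _ _ Ω e) ∧
    ∀ (Ω : JetGeom.VinE S 1 2 (n + 1)) (e : JetGeom.VinE S 2 2 (n + 1)),
      JetGeom.IsPresymplectic S L θ Ω → DiffCalc.Represents _ _ Ω e → e ≠ 0 →
        ∃ (e₀ : JetGeom.VinE S 0 0 n) (e₁ : JetGeom.VinE S 1 0 n) (e₂ : JetGeom.VinE S 2 0 n),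
          DiffCalc.IsClassOf _ _ (DiffCalc.restrictForm (JetGeom.vanishingIdeal S) n L) e₀ ∧
          DiffCalc.Represents _ _ e₀ e₁ ∧ e₁ ≠ 0 ∧
          DiffCalc.Represents _ _ e₁ e₂ ∧ e₂ ≠ 0 := by
  refine DiffCalc.represents_and_ne_zero_of_d_mem (DiffCalc.dOn_dOn (JetGeom.vanishingIdeal S))
    (JetGeom.cartanFiltration_succ_le S) (JetGeom.cartanFiltration_zero S n)
    (JetGeom.cartanFiltration_zero S (n + 1))
    -- Forms of degree n + 1 vanish on the n-dimensional Cartan planes, so F¹ is everything in that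
    -- degree.
    (JetGeom.cartanFiltration_eq_top fun η ρ _ => JetGeom.inCartanPowAt_one_of_degree_gt η.2 ρ)
    (L := DiffCalc.restrictForm (JetGeom.vanishingIdeal S) n L)
    (θ := DiffCalc.restrictForm (JetGeom.vanishingIdeal S) n θ)
    (JetGeom.restrictForm_mem_cartanFiltration fun ρ _ => hθ.1 ρ) ?_
  exact JetGeom.restrictForm_mem_cartanFiltration (θ := DiffCalc.dForms n (L + θ)) fun ρ hρ =>
    JetGeom.inCartanPowAt_two_extD L.2 θ.2 hL hθ (hE ρ hρ)
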